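/- Consider a polling system with $N\ge 1$ queues $Q_1,\dots,Q_N$ (indices modulo $N$) and one server, who repeats the cycle of periods $V_1,S_1,V_2,S_2,\dots,V_N,S_N$, where $V_j$ is the visit to $Q_j$ and $S_j$ the switch-over from $Q_j$ to $Q_{j+1}$. Type $i$ customers arrive at $Q_i$ according to a Poisson process of rate $\lambda_i>0$; put $\Lambda=\sum_{i=1}^N\lambda_i$. Service times of type $i$ are i.i.d. copies of $B_i\in[0,\infty)$, switch-over times from $Q_j$ are i.i.d. copies of a $[0,\infty)$-valued random variable, and arrival processes, service times and switch-over times are independent. Each queue receives either gated service (exactly the customers present when the visit starts are served) or exhaustive service (the queue is served until it is empty). At the moment that a period $P\in\{V_1,S_1,\dots,V_N,S_N\}$ starts, before any service in $P$, each customer waiting in $Q_i$ leaves the system, independently of everything else, with probability $p_i^{(P)}\in[0,1]$; put $q_i^{(P)}=1-p_i^{(P)}$. Customers leave unserved at no other moments. Define, for $l=1,\dots,N$, $$\lambda_i^{(S_{i-l})}=\lambda_i\,q_i^{(V_i)}\prod_{k=1}^{l-1}q_i^{(V_{i-k})}q_i^{(S_{i-k})},\qquad \lambda_i^{(V_{i-l})}=q_i^{(S_{i-l})}\,\lambda_i^{(S_{i-l})},$$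 except that $\lambda_i^{(V_i)}=\lambda_i$ (the case $l=N$ of the second formula) if $Q_i$ receives exhaustive service. Assume that the system starts at the beginning of a cycle (a start of $V_1$, just before the reneging there), with initial queue lengths independent of the arrivals, services, switch-overs and reneging decisions, and that it is in steady state: the joint law of the queue lengths at the start of a cycle and of the lengths of the $2N$ periods of that cycle is the same for all cycles. Let $\mathbb E[V_j]$, $\mathbb E[S_j]$ and $\mathbb E[C]$ be the mean lengths of $V_j$, $S_j$ and of a whole cycle, and assume $0<\mathbb E[C]<\infty$. Let $r_i$ be the probability that an arbitrary type $i$ customer is eventually served, i.e. the expected number of type $i$ customers who arrive during a given cycle and are eventually served (in that or a later cycle) divided by the expected number of type $i$ customers who arrive during that cycle; let $r$ be the same ratio for customers of all types together. Then for every choice of the cycle the expected number of type $i$ arrivals in it is positive and finite for each $i$, and $$r_i=\sum_{j=1}^N\left(\frac{\mathbb E[V_j]}{\mathbb E[C]}\,\frac{\lambda_i^{(V_j)}}{\lambda_i}+\frac{\mathbb E[S_j]}{\mathbb E[C]}\,\frac{\lambda_i^{(S_j)}}{\lambda_i}\right),\quad i=1,\dots,N,\qquad r=\sum_{i=1}^N\frac{\lambda_i}{\Lambda}\,r_i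 .$$ -/

import Mathlib

open MeasureTheory ProbabilityTheory
open scoped ENNReal NNReal unitInterval

noncomputable section

namespace Polling

/-- Service disciplines. -/
inductive Discipline
  | gated
  | exhaustive

/-- The `2 N` periods of a cycle: the visit `V_j` to queue `j` and the switch-over `S_j` from
queue `j` to the next queue (queues are numbered cyclically by `Fin N`). -/
inductive Period (N : ℕ)
  | visit (j : Fin N)
  | switch (j : Fin N)

/-- Parameters of a cyclic polling model with synchronised reneging at polling instants. -/
structure Model (N : ℕ) where
  /-- arrival rate `λ_i` of the Poisson process of type `i` customers -/
  rate : Fin N → ℝ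
  rate_pos : ∀ i, 0 < rate i
  /-- law of the service time `B_i` -/
  serviceLaw : Fin N → ProbabilityMeasure ℝ≥0
  /-- law of the switch-over time `S_i` -/
  switchLaw : Fin N → ProbabilityMeasure ℝ≥0
  discipline : Fin N → Discipline
  /-- `renege i P` is the probability `p_i^{(P)}` that a waiting type `i` customer leaves at the
  start of a period `P` -/
  renege : Fin N → Period N → I

/-- Labels of customers of one type: `Sum.inl k` for those present at time `0`, `Sum.inr k` for the
`k`-th arrival (`k = 0, 1, …`) after time `0`. -/
abbrev Customer := ℕ ⊕ ℕ

/-- The primitive random data: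
initial queue lengths; interarrival times (type, index); service times (type, customer);
switch-over times (queue, stage); reneging decisions (type, customer, stage).
Stages `0, 1, 2, …` number the successive periods; stage `0` is a visit to the first queue. -/
abbrev Scenario (N : ℕ) :=
  (Fin N → ℕ) × (Fin N × ℕ → ℝ) × (Fin N × Customer → ℝ≥0) × (Fin N × ℕ → ℝ≥0) ×
    (Fin N × Customer × ℕ → Bool)

variable {N : ℕ} [NeZero N]

/-- The period that takes place at stage `m`: `V_1, S_1, …, V_N, S_N, V_1, S_1, …`. -/
def stagePeriod (m : ℕ) : Period N :=
  if m % 2 = 0 then Period.visit (Fin.ofNat N (m / 2)) else Period.switch (Fin.ofNat N (m / 2))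

/-- The stage at which the period `P` of cycle `n` takes place. -/
def stageOf (n : ℕ) : Period N → ℕ
  | Period.visit j => 2 * (N * n + j)
  | Period.switch j => 2 * (N * n + j) + 1

/-- The law of the primitive data: all of them are independent, the initial queue lengths have joint
law `π`, the interarrival times of type `i` are exponential with rate `λ_i`, and a type `i` customer
decides (value `true`) to renege at stage `m` with probability `p_i^{(P)}`, where `P` is the period
of that stage. -/
def law (M : Model N) (π : ProbabilityMeasure (Fin N → ℕ)) : Measure (Scenario N) :=
  (π : Measure (Fin N → ℕ)).prod <|
  (Measure.infinitePi fun a : Fin N × ℕ => expMeasure (M.rate a.1)).prod <|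
  (Measure.infinitePi fun b : Fin N × Customer => (M.serviceLaw b.1 : Measure ℝ≥0)).prod <|
  (Measure.infinitePi fun s : Fin N × ℕ => (M.switchLaw s.1 : Measure ℝ≥0)).prod <|
  (Measure.infinitePi fun d : Fin N × Customer × ℕ =>
    bernoulliMeasure true false (M.renege d.1 (stagePeriod d.2.2)))

section Dynamics

def initialLength (ω : Scenario N) (i : Fin N) : ℕ := ω.1 i

def interarrival (ω : Scenario N) (i : Fin N) (k : ℕ) : ℝ := ω.2.1 (i, k)

def serviceTime (ω : Scenario N) (i : Fin N) (c : Customer) : ℝ≥0 := ω.2.2.1 (i, c)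

def switchTime (ω : Scenario N) (j : Fin N) (m : ℕ) : ℝ≥0 := ω.2.2.2.1 (j, m)

def wantsToLeave (ω : Scenario N) (i : Fin N) (c : Customer) (m : ℕ) : Bool :=
  ω.2.2.2.2 (i, c, m)

/-- Epoch of the `k`-th arrival of type `i` after time `0`. -/
def arrivalEpoch (ω : Scenario N) (i : Fin N) (k : ℕ) : ℝ≥0∞ :=
  ∑ l ∈ Finset.range (k + 1), ENNReal.ofReal (interarrival ω i l)

/-- The type `i` customers who arrive during the time interval `(a, b]`. -/
def arrivals (ω : Scenario N) (i : Fin N) (a b : ℝ≥0∞) : Set Customer :=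
  {c | ∃ k, c = Sum.inr k ∧ a < arrivalEpoch ω i k ∧ arrivalEpoch ω i k ≤ b}

/-- Total service requirement of a set of type `i` customers. -/
def work (ω : Scenario N) (i : Fin N) (A : Set Customer) : ℝ≥0∞ :=
  ∑' c : A, (serviceTime ω i c : ℝ≥0∞)

/-- State of the system at a polling instant, just before the reneging that takes place there. -/
structure State (N : ℕ) where
  /-- the current time (`⊤` if the stage is never reached) -/
  time : ℝ≥0∞
  /-- the customers waiting in each queue -/
  waiting : Fin N → Set Customer

/-- The type `i` customers who are still present after the reneging at the start of stage `m`. -/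
def staying (ω : Scenario N) (m : ℕ) (s : State N) (i : Fin N) : Set Customer :=
  {c | c ∈ s.waiting i ∧ wantsToLeave ω i c m = false}

/-- Length of the period of stage `m` that starts in state `s`. A gated visit lasts as long as it
takes to serve those present after the reneging. An exhaustive visit lasts until the first time
at which all these and all customers of that type who arrived in the meantime have been served
(`⊤` if this never happens). -/
def duration (M : Model N) (ω : Scenario N) (m : ℕ) (s : State N) : ℝ≥0∞ :=
  match (stagePeriod m : Period N) with
  | Period.switch j => (switchTime ω j m : ℝ≥0∞)
  | Period.visit j =>
    match M.discipline j with
    | Discipline.gated => work ω j (staying ω m s j)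
    | Discipline.exhaustive =>
      sInf {t : ℝ≥0∞ |
        work ω j (staying ω m s j) + work ω j (arrivals ω j s.time (s.time + t)) ≤ t}

/-- The type `i` customers who are served during stage `m`: nobody unless this stage is a visit to
queue `i`; otherwise those present after the reneging and, if the service is exhaustive, also those
who arrive during the visit. -/
def served (M : Model N) (ω : Scenario N) (m : ℕ) (s : State N) (i : Fin N) : Set Customer :=
  {c | stagePeriod m = Period.visit i ∧ s.time < ⊤ ∧
    (c ∈ staying ω m s i ∨
      (M.discipline i = Discipline.exhaustive ∧
        c ∈ arrivals ω i s.time (s.time + duration M ω m s)))}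

/-- The state at the start of stage `m`. -/
def stateAt (M : Model N) (ω : Scenario N) : ℕ → State N
  | 0 => ⟨0, fun i => {c | ∃ k < initialLength ω i, c = Sum.inl k}⟩
  | m + 1 =>
    let s := stateAt M ω m
    let t := s.time + duration M ω m s
    ⟨t, fun i => (staying ω m s i ∪ arrivals ω i s.time t) \ served M ω m s i⟩

/-- Length of the period of stage `m`. -/
def periodLength (M : Model N) (ω : Scenario N) (m : ℕ) : ℝ≥0∞ :=
  duration M ω m (stateAt M ω m)

/-- Number of type `i` customers waiting at the start of stage `m`, before the reneging. -/
def queueLength (M : Model N) (ω : Scenario N) (m : ℕ) (i : Fin N) : ℕ∞ :=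
  ((stateAt M ω m).waiting i).encard

/-- The type `i` customers who are eventually served. -/
def eventuallyServed (M : Model N) (ω : Scenario N) (i : Fin N) : Set Customer :=
  {c | ∃ m, c ∈ served M ω m (stateAt M ω m) i}

/-- Length of cycle `n`, which consists of the stages `2 N n, …, 2 N (n + 1) - 1`. -/
def cycleLength (M : Model N) (ω : Scenario N) (n : ℕ) : ℝ≥0∞ :=
  ∑ m ∈ Finset.Ico (2 * N * n) (2 * N * (n + 1)), periodLength M ω m

/-- The type `i` customers who arrive during cycle `n`. -/
def cycleArrivals (M : Model N) (ω : Scenario N) (n : ℕ) (i : Fin N) : Set Customer :=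
  arrivals ω i (stateAt M ω (2 * N * n)).time (stateAt M ω (2 * N * (n + 1))).time

/-- Queue lengths at the start of cycle `n` together with the lengths of its `2 N` periods. -/
def cycleRecord (M : Model N) (n : ℕ) (ω : Scenario N) :
    (Fin N → ℕ∞) × (Fin (2 * N) → ℝ≥0∞) :=
  (queueLength M ω (2 * N * n), fun l => periodLength M ω (2 * N * n + l))

end Dynamics

section Steady

variable (M : Model N) (π : ProbabilityMeasure (Fin N → ℕ))

/-- The system is in steady state when it starts with initial queue length distribution `π`:
all cycles have the same law. -/
def IsSteadyState : Prop :=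
  ∀ n, IdentDistrib (cycleRecord M n) (cycleRecord M 0) (law M π) (law M π)

/-- The mean length `E[C]` of a (steady-state) cycle. -/
def meanCycle : ℝ≥0∞ := ∫⁻ ω, cycleLength M ω 0 ∂(law M π)

/-- The mean length `E[P]` of the period `P` of a (steady-state) cycle. -/
def meanPeriod (P : Period N) : ℝ≥0∞ := ∫⁻ ω, periodLength M ω (stageOf 0 P) ∂(law M π)

/-- Expected number of type `i` customers who arrive during cycle `n`. -/
def meanArrivals (n : ℕ) (i : Fin N) : ℝ≥0∞ :=
  ∫⁻ ω, ((cycleArrivals M ω n i).encard : ℝ≥0∞) ∂(law M π)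

/-- Expected number of type `i` customers who arrive during cycle `n` and are eventually served
(possibly during a later cycle). -/
def meanServed (n : ℕ) (i : Fin N) : ℝ≥0∞ :=
  ∫⁻ ω, ((cycleArrivals M ω n i ∩ eventuallyServed M ω i).encard : ℝ≥0∞) ∂(law M π)

/-- The probability `r_i` that an arbitrary (Palm-typical) type `i` customer arriving during cycle
`n` is eventually served. -/
def servedProbOfType (n : ℕ) (i : Fin N) : ℝ :=
  (meanServed M π n i / meanArrivals M π n i).toReal

/-- The probability `r` that an arbitrary (Palm-typical) customer, of any type, arriving during
cycle `n` is eventually served. -/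
def servedProb (n : ℕ) : ℝ :=
  ((∑ i, meanServed M π n i) / ∑ i, meanArrivals M π n i).toReal

end Steady

section Rates

variable (M : Model N)

/-- `q_i^{(P)} = 1 - p_i^{(P)}`. -/
def stayProb (i : Fin N) (P : Period N) : ℝ := 1 - (M.renege i P : ℝ)

/-- The number `l ∈ {1, …, N}` with `j = i - l` modulo `N`. -/
def lag (i j : Fin N) : ℕ := if j = i then N else ((i - j : Fin N) : ℕ)

/-- `λ_i q_i^{(V_i)} ∏_{1 ≤ k < l} q_i^{(V_{i-k})} q_i^{(S_{i-k})}` for `j = i - l`, `1 ≤ l ≤ N`: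
the arrival intensity `λ_i^{(S_j)}`. -/
def rateDuringSwitch (i j : Fin N) : ℝ :=
  M.rate i * stayProb M i (Period.visit i) *
    ∏ k ∈ Finset.Ico 1 (lag i j),
      (stayProb M i (Period.visit (i - Fin.ofNat N k)) *
        stayProb M i (Period.switch (i - Fin.ofNat N k)))

open Classical in
/-- The arrival intensity `λ_i^{(V_j)}`. -/
def rateDuringVisit (i j : Fin N) : ℝ :=
  if j = i ∧ M.discipline i = Discipline.exhaustive then M.rate i
  else stayProb M i (Period.switch j) * rateDuringSwitch M i j

end Rates

end Polling

end

/-! The formula is a ratio of two expectations, each computed period by period. Numerator and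
denominator are sums of probabilities over the index `k` of the arriving customer.

Arrivals: the start of a stage is a nonanticipating time for the Poisson clocks. For one exponential
clock `X` of rate `r`, `r E[min(X, u)] = P(X ≤ u)`. Freezing all other data and summing this over
successive clocks gives Wald's identity (`tsum_law_arrivalEpoch_le`). Subtracting it at two
consecutive stages shows that a period attracts on average `λ_i` times its mean length of type `i`
customers (`tsum_law_stageArrivals`).

Service: a customer arriving during stage `m` is served at once if an exhaustive visit to the own
queue is under way. Otherwise the customer is served exactly when no polling instant after `m`, up
to and including the next visit to that queue, makes the customer leave
(`inr_mem_eventuallyServed_iff`). The event of arriving during stage `m` does not involve decisions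
at later stages, so independence yields a product of staying probabilities
(`law_inter_forall_stay`). Multiplied by `λ_i`, this product is the rate in the theorem
(`rate_mul_prod_switch`, `rate_mul_prod_visit`).

Stationarity replaces mean period lengths in cycle `n` by those in cycle `0`. Finiteness of `E[C]`
makes all stage times integrable, which justifies the subtraction. -/

set_option linter.unusedSectionVars false

namespace Polling

/-! ### Resampling a coordinate of a product measure -/

/-- Resampling one coordinate preserves an infinite product measure. -/
lemma measurePreserving_update_infinitePi {ι : Type*} [DecidableEq ι] {X : ι → Type*}
    [∀ i, MeasurableSpace (X i)] (μ : (i : ι) → Measure (X i))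
    [∀ i, IsProbabilityMeasure (μ i)] (a : ι) :
    MeasurePreserving (fun p : (∀ i, X i) × X a => Function.update p.1 a p.2)
      ((Measure.infinitePi μ).prod (μ a)) (Measure.infinitePi μ) := by
  have hm : Measurable fun p : (∀ i, X i) × X a => Function.update p.1 a p.2 :=
    measurable_update'
  refine ⟨hm, ?_⟩
  refine Measure.eq_infinitePi μ fun s t ht => ?_
  rw [Measure.map_apply hm (MeasurableSet.pi s.countable_toSet fun i _ => ht i)]
  by_cases ha : a ∈ s
  · have : (fun p : (∀ i, X i) × X a => Function.update p.1 a p.2) ⁻¹' (Set.pi s t) =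
        (Set.pi (s.erase a : Finset ι) t) ×ˢ t a := by
      ext p
      simp only [Set.mem_preimage, Set.mem_pi, Set.mem_prod, Finset.mem_coe, Finset.mem_erase]
      constructor
      · intro h
        refine ⟨fun i hi => ?_, ?_⟩
        · simpa [Function.update_of_ne hi.1] using h i hi.2
        · simpa using h a ha
      · rintro ⟨h1, h2⟩ i hi
        by_cases hia : i = a
        · subst hia; simpa using h2
        · simpa [Function.update_of_ne hia] using h1 i ⟨hia, hi⟩
    rw [this, Measure.prod_prod, Measure.infinitePi_pi _ fun i _ => ht i,
      Finset.prod_erase_mul s _ ha]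
  · have : (fun p : (∀ i, X i) × X a => Function.update p.1 a p.2) ⁻¹' (Set.pi s t) =
        (Set.pi (s : Set ι) t) ×ˢ Set.univ := by
      ext p
      simp only [Set.mem_preimage, Set.mem_pi, Set.mem_prod, Finset.mem_coe, Set.mem_univ,
        and_true]
      refine forall₂_congr fun i hi => ?_
      rw [Function.update_of_ne (by rintro rfl; exact ha hi)]
    rw [this, Measure.prod_prod, Measure.infinitePi_pi _ fun i _ => ht i, measure_univ, mul_one]

/-- A factor that is left untouched can be carried along. Since `law` is a nested product,
alternating this with the left-hand version reaches any of its coordinates. -/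
lemma MeasurePreserving.resample_prod_right {Ω Ω' X : Type*} [MeasurableSpace Ω]
    [MeasurableSpace Ω'] [MeasurableSpace X] {μ : Measure Ω} {ν : Measure X} [SFinite μ] [SFinite ν]
    {f : Ω × X → Ω} (hf : MeasurePreserving f (μ.prod ν) μ) (ρ : Measure Ω') [SFinite ρ] :
    MeasurePreserving (fun p : (Ω' × Ω) × X => (p.1.1, f (p.1.2, p.2)))
      ((ρ.prod μ).prod ν) (ρ.prod μ) :=
  ((MeasurePreserving.id ρ).prod hf).comp (measurePreserving_prodAssoc ρ μ ν)

lemma MeasurePreserving.resample_prod_left {Ω Ω' X : Type*} [MeasurableSpace Ω]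
    [MeasurableSpace Ω'] [MeasurableSpace X] {μ : Measure Ω} {ν : Measure X} [SFinite μ] [SFinite ν]
    {f : Ω × X → Ω} (hf : MeasurePreserving f (μ.prod ν) μ) (ρ : Measure Ω') [SFinite ρ] :
    MeasurePreserving (fun p : (Ω × Ω') × X => (f (p.1.1, p.2), p.1.2))
      ((μ.prod ρ).prod ν) (μ.prod ρ) :=
  Measure.measurePreserving_swap.comp ((MeasurePreserving.resample_prod_right hf ρ).comp
    (Measure.measurePreserving_swap.prod (MeasurePreserving.id ν)))

/-! ### The exponential law and its compensator -/

lemma expMeasure_eq_withDensity (r : ℝ) :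
    expMeasure r = volume.withDensity (exponentialPDF r) := rfl

instance (r : ℝ) : NullSingletonClass (expMeasure r) := by
  rw [expMeasure_eq_withDensity]; infer_instance

lemma expMeasure_Iic_zero {r : ℝ} (hr : 0 < r) : expMeasure r (Set.Iic 0) = 0 := by
  rw [expMeasure_eq_withDensity, withDensity_apply _ measurableSet_Iic,
    lintegral_exponentialPDF_eq_antiDeriv hr]
  simp

lemma expMeasure_Ioi {r : ℝ} (hr : 0 < r) {t : ℝ} (ht : 0 ≤ t) :
    expMeasure r (Set.Ioi t) = ENNReal.ofReal (Real.exp (-(r * t))) := by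
  have := isProbabilityMeasure_expMeasure hr
  have h1 : expMeasure r (Set.Iic t) = ENNReal.ofReal (1 - Real.exp (-(r * t))) := by
    rw [expMeasure_eq_withDensity, withDensity_apply _ measurableSet_Iic,
      lintegral_exponentialPDF_eq_antiDeriv hr, if_pos ht]
  rw [← Set.compl_Iic, measure_compl measurableSet_Iic (measure_ne_top _ _), measure_univ, h1,
    ← ENNReal.ofReal_one, ← ENNReal.ofReal_sub]
  · congr 1; ring
  · rw [sub_nonneg, Real.exp_le_one_iff]
    have := mul_nonneg hr.le ht
    linarith

/-- The compensator identity for a single exponential waiting time truncated at `u`. -/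
lemma rate_mul_lintegral_min_expMeasure {r : ℝ} (hr : 0 < r) (u : ℝ≥0∞) :
    ENNReal.ofReal r * ∫⁻ x, min (ENNReal.ofReal x) u ∂(expMeasure r) =
      expMeasure r {x | ENNReal.ofReal x ≤ u} := by
  have := isProbabilityMeasure_expMeasure hr
  have hmS : MeasurableSet {t : ℝ | 0 < t ∧ ENNReal.ofReal t < u} :=
    measurableSet_Ioi.inter (ENNReal.measurable_ofReal measurableSet_Iio)
  set S : Set ℝ := {t : ℝ | 0 < t ∧ ENNReal.ofReal t < u} with hS
  have hmin : ∀ x : ℝ, min (ENNReal.ofReal x) u =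
      ∫⁻ t in S, (Set.Ioi t).indicator 1 x := by
    intro x
    have : ∀ t, (Set.Ioi t).indicator (1 : ℝ → ℝ≥0∞) x = (Set.Iio x).indicator 1 t := fun t => by
      simp [Set.indicator_apply]
    simp_rw [this]
    rw [lintegral_indicator_one measurableSet_Iio, Measure.restrict_apply measurableSet_Iio]
    rcases eq_or_ne u ⊤ with rfl | hu
    · have : Set.Iio x ∩ S = Set.Ioo 0 x := by ext t; simp [hS, and_comm]
      rw [this, Real.volume_Ioo]; simp
    · have : Set.Iio x ∩ S = Set.Ioo 0 (min x u.toReal) := by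
        ext t
        simp only [hS, Set.mem_inter_iff, Set.mem_Iio, Set.mem_ofPred_eq, Set.mem_Ioo, lt_min_iff]
        constructor
        · rintro ⟨h1, h2, h3⟩
          exact ⟨h2, h1, (ENNReal.ofReal_lt_iff_lt_toReal h2.le hu).1 h3⟩
        · rintro ⟨h2, h1, h3⟩
          exact ⟨h1, h2, (ENNReal.ofReal_lt_iff_lt_toReal h2.le hu).2 h3⟩
      rw [this, Real.volume_Ioo, sub_zero, ENNReal.ofReal_min, ENNReal.ofReal_toReal hu]
  simp_rw [hmin]
  rw [lintegral_lintegral_swap]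
  swap
  · apply Measurable.aemeasurable
    have : (Function.uncurry fun (x : ℝ) (t : ℝ) => (Set.Ioi t).indicator (1 : ℝ → ℝ≥0∞) x) =
        {p : ℝ × ℝ | p.2 < p.1}.indicator 1 := by
      ext p; simp [Function.uncurry, Set.indicator_apply]
    rw [this]
    exact measurable_one.indicator (measurableSet_lt measurable_snd measurable_fst)
  simp_rw [lintegral_indicator_one measurableSet_Ioi]
  rw [← lintegral_const_mul' _ _ ENNReal.ofReal_ne_top]
  -- The two sets differ only on the nonpositive half-line and at the endpoint `u`, both null. For
  -- `u = ⊤` the excluded point is `0`, which is harmless.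
  have h1 : expMeasure r {x | ENNReal.ofReal x ≤ u} = expMeasure r S := by
    apply measure_congr
    have h0 : ∀ᵐ x ∂(expMeasure r), x ∉ Set.Iic (0 : ℝ) :=
      measure_eq_zero_iff_ae_notMem.1 (expMeasure_Iic_zero hr)
    have h2 : ∀ᵐ x ∂(expMeasure r), x ∉ ({u.toReal} : Set ℝ) :=
      measure_eq_zero_iff_ae_notMem.1 (measure_singleton _)
    filter_upwards [h0, h2] with x hx0 hx2
    simp only [Set.mem_Iic, not_le, Set.mem_singleton_iff] at hx0 hx2
    apply propext
    change (ENNReal.ofReal x ≤ u) ↔ (0 < x ∧ ENNReal.ofReal x < u)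
    refine ⟨fun h => ⟨hx0, lt_of_le_of_ne h fun h' => hx2 ?_⟩, fun h => h.2.le⟩
    rw [← h', ENNReal.toReal_ofReal hx0.le]
  rw [h1, expMeasure_eq_withDensity, withDensity_apply _ hmS, ← expMeasure_eq_withDensity]
  refine setLIntegral_congr_fun hmS fun t ht => ?_
  rw [expMeasure_Ioi hr ht.1.le, exponentialPDF_of_nonneg ht.1.le, ENNReal.ofReal_mul hr.le]

lemma bernoulliMeasure_false (p : I) :
    bernoulliMeasure true false p {false} = ENNReal.ofReal (1 - (p : ℝ)) := by
  rw [bernoulliMeasure_apply _ (measurableSet_singleton _)]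
  simp only [Set.mem_singleton_iff, if_true, reduceCtorEq, if_false]
  exact ENNReal.coe_nnreal_eq _

/-! ### Resampling one clock or one decision under `law` -/

section Law

variable {N : ℕ} [NeZero N]

instance (M : Model N) (i : Fin N) : IsProbabilityMeasure (expMeasure (M.rate i)) :=
  isProbabilityMeasure_expMeasure (M.rate_pos i)

instance (M : Model N) (π : ProbabilityMeasure (Fin N → ℕ)) : IsProbabilityMeasure (law M π) := by
  unfold law; infer_instance

/-- The scenario `ω` with the `k`-th interarrival time of type `i` replaced by `x`. -/
def setInterarrival (ω : Scenario N) (i : Fin N) (k : ℕ) (x : ℝ) : Scenario N :=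
  (ω.1, Function.update ω.2.1 (i, k) x, ω.2.2)

/-- The scenario `ω` with one reneging decision replaced by `b`. -/
def setDecision (ω : Scenario N) (d : Fin N × Customer × ℕ) (b : Bool) : Scenario N :=
  (ω.1, ω.2.1, ω.2.2.1, ω.2.2.2.1, Function.update ω.2.2.2.2 d b)

lemma measurePreserving_setInterarrival (M : Model N) (π : ProbabilityMeasure (Fin N → ℕ))
    (i : Fin N) (k : ℕ) :
    MeasurePreserving (fun p : Scenario N × ℝ => setInterarrival p.1 i k p.2)
      ((law M π).prod (expMeasure (M.rate i))) (law M π) := by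
  unfold law
  exact MeasurePreserving.resample_prod_right (MeasurePreserving.resample_prod_left
    (measurePreserving_update_infinitePi (fun a : Fin N × ℕ => expMeasure (M.rate a.1)) (i, k)) _) _

lemma measurePreserving_setDecision (M : Model N) (π : ProbabilityMeasure (Fin N → ℕ))
    (d : Fin N × Customer × ℕ) :
    MeasurePreserving (fun p : Scenario N × Bool => setDecision p.1 d p.2)
      ((law M π).prod (bernoulliMeasure true false (M.renege d.1 (stagePeriod d.2.2))))
      (law M π) := by
  unfold law
  exact MeasurePreserving.resample_prod_right (MeasurePreserving.resample_prod_right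
    (MeasurePreserving.resample_prod_right (MeasurePreserving.resample_prod_right
      (measurePreserving_update_infinitePi (fun d : Fin N × Customer × ℕ =>
        bernoulliMeasure true false (M.renege d.1 (stagePeriod d.2.2))) d) _) _) _) _

/-- Fubini for the resampled scenario. The old value of the clock is overwritten, so the inner
integral amounts to conditioning on all other data. -/
lemma lintegral_law_setInterarrival (M : Model N) (π : ProbabilityMeasure (Fin N → ℕ))
    (i : Fin N) (k : ℕ) {F : Scenario N → ℝ≥0∞} (hF : Measurable F) :
    ∫⁻ ω, F ω ∂(law M π) =
      ∫⁻ ω, ∫⁻ x, F (setInterarrival ω i k x) ∂(expMeasure (M.rate i)) ∂(law M π) := by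
  have h := measurePreserving_setInterarrival M π i k
  exact (h.lintegral_comp hF).symm.trans (lintegral_prod _ (hF.comp h.measurable).aemeasurable)

lemma lintegral_law_setDecision (M : Model N) (π : ProbabilityMeasure (Fin N → ℕ))
    (d : Fin N × Customer × ℕ) {F : Scenario N → ℝ≥0∞} (hF : Measurable F) :
    ∫⁻ ω, F ω ∂(law M π) =
      ∫⁻ ω, ∫⁻ b, F (setDecision ω d b)
        ∂(bernoulliMeasure true false (M.renege d.1 (stagePeriod d.2.2))) ∂(law M π) := by
  have h := measurePreserving_setDecision M π d
  exact (h.lintegral_comp hF).symm.trans (lintegral_prod _ (hF.comp h.measurable).aemeasurable)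

end Law

/-! ### Sample paths: busy periods, dependence on the past, fate of a customer -/

section Paths

variable {N : ℕ} [NeZero N]

lemma arrivalEpoch_mono (ω : Scenario N) (i : Fin N) : Monotone (arrivalEpoch ω i) :=
  fun _ _ h => Finset.sum_le_sum_of_subset (Finset.range_mono (by lia))

lemma inr_mem_arrivals {ω : Scenario N} {i : Fin N} {a b : ℝ≥0∞} {k : ℕ} :
    Sum.inr k ∈ arrivals ω i a b ↔ a < arrivalEpoch ω i k ∧ arrivalEpoch ω i k ≤ b := by
  simp [arrivals]

lemma inl_notMem_arrivals {ω : Scenario N} {i : Fin N} {a b : ℝ≥0∞} {k : ℕ} :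
    Sum.inl k ∉ arrivals ω i a b := by
  simp [arrivals]

lemma work_mono (ω : Scenario N) (i : Fin N) {A B : Set Customer} (h : A ⊆ B) :
    work ω i A ≤ work ω i B :=
  ENNReal.tsum_mono_subtype (fun c => (serviceTime ω i c : ℝ≥0∞)) h

lemma arrivals_mono (ω : Scenario N) (i : Fin N) (a : ℝ≥0∞) {b b' : ℝ≥0∞} (h : b ≤ b') :
    arrivals ω i a b ⊆ arrivals ω i a b' := by
  rintro c ⟨k, rfl, h1, h2⟩
  exact ⟨k, rfl, h1, h2.trans h⟩

/-- The type `i` customers with index below `k` who arrive after time `a`. -/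
def arrivalsBelow (ω : Scenario N) (i : Fin N) (a : ℝ≥0∞) (k : ℕ∞) : Set Customer :=
  {c | ∃ l : ℕ, c = Sum.inr l ∧ (l : ℕ∞) < k ∧ a < arrivalEpoch ω i l}

/-- Arrival epochs are nondecreasing in the index, so those up to `b` form an initial segment,
possibly all of them (`k = ⊤`). -/
lemma exists_arrivals_eq_arrivalsBelow (ω : Scenario N) (i : Fin N) (a b : ℝ≥0∞) :
    ∃ k, arrivals ω i a b = arrivalsBelow ω i a k := by
  classical
  by_cases h : ∃ l, b < arrivalEpoch ω i l
  · refine ⟨(Nat.find h : ℕ), Set.ext fun c => exists_congr fun l => ?_⟩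
    have : arrivalEpoch ω i l ≤ b ↔ l < Nat.find h := by
      rw [Nat.lt_find_iff]
      exact ⟨fun h1 m hm => not_lt.2 ((arrivalEpoch_mono ω i hm).trans h1),
        fun h1 => not_lt.1 (h1 l le_rfl)⟩
    rw [this, Nat.cast_lt]
    tauto
  · push Not at h
    refine ⟨⊤, Set.ext fun c => exists_congr fun l => ?_⟩
    simp [h l]

/-- Total service requirement of `A` and the arrivals during `(a, a + t]`. -/
noncomputable def workload (ω : Scenario N) (i : Fin N) (A : Set Customer) (a t : ℝ≥0∞) : ℝ≥0∞ :=
  work ω i A + work ω i (arrivals ω i a (a + t))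

/-- Total service requirement of `A` and the arrivals after `a` of index below `k`. -/
noncomputable def workBelow (ω : Scenario N) (i : Fin N) (A : Set Customer) (a : ℝ≥0∞) (k : ℕ∞) : ℝ≥0∞ :=
  work ω i A + work ω i (arrivalsBelow ω i a k)

lemma workload_mono (ω : Scenario N) (i : Fin N) (A : Set Customer) (a : ℝ≥0∞) :
    Monotone (workload ω i A a) := fun _ _ h => by
  unfold workload
  gcongr
  exact work_mono _ _ (arrivals_mono _ _ _ (by gcongr))

lemma workBelow_mono (ω : Scenario N) (i : Fin N) (A : Set Customer) (a : ℝ≥0∞) :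
    Monotone (workBelow ω i A a) := fun _ _ h => by
  unfold workBelow
  gcongr
  refine work_mono _ _ ?_
  rintro c ⟨l, rfl, h1, h2⟩
  exact ⟨l, rfl, h1.trans_le h, h2⟩

/-- If `t` covers the workload at `t`, then so does the value `w` of that workload: `w ≤ t` and
monotonicity give workload at `w` at most `w`. Only countably many values `w` are possible, one for
each number of arrivals. -/
lemma exists_workBelow_le {ω : Scenario N} {i : Fin N} {A : Set Customer} {a t : ℝ≥0∞}
    (ht : workload ω i A a t ≤ t) :
    ∃ k, workload ω i A a (workBelow ω i A a k) ≤ workBelow ω i A a k ∧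
      workBelow ω i A a k ≤ t := by
  obtain ⟨k, hk⟩ := exists_arrivals_eq_arrivalsBelow ω i a (a + t)
  have h : workload ω i A a t = workBelow ω i A a k := by rw [workload, hk, workBelow]
  refine ⟨k, ?_, h ▸ ht⟩
  rw [← h]
  exact workload_mono _ _ _ _ ht

open Classical in
/-- A busy period has ended at one of countably many candidate times. -/
lemma sInf_workload_eq_iInf (ω : Scenario N) (i : Fin N) (A : Set Customer) (a : ℝ≥0∞) :
    sInf {t | workload ω i A a t ≤ t} =
      ⨅ k : ℕ∞, if workload ω i A a (workBelow ω i A a k) ≤ workBelow ω i A a k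
        then workBelow ω i A a k else ⊤ := by
  refine le_antisymm (le_iInf fun k => ?_) (le_sInf fun t ht => ?_)
  · split_ifs with h
    · exact sInf_le h
    · exact le_top
  · obtain ⟨k, h1, h2⟩ := exists_workBelow_le ht
    exact (iInf_le _ k).trans (by rwa [if_pos h1])

/-- The infimum is attained because `ℕ∞` is well ordered and the candidate times increase with the
index. The trivial solution `t = ⊤` ensures that there is a candidate. -/
lemma sInf_workload_mem (ω : Scenario N) (i : Fin N) (A : Set Customer) (a : ℝ≥0∞) :
    sInf {t | workload ω i A a t ≤ t} ∈ {t | workload ω i A a t ≤ t} := by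
  let K : Set ℕ∞ := {k | workload ω i A a (workBelow ω i A a k) ≤ workBelow ω i A a k}
  have hK : K.Nonempty := by
    obtain ⟨k, hk, -⟩ := exists_workBelow_le (ω := ω) (i := i) (A := A) (a := a) (t := ⊤) le_top
    exact ⟨k, hk⟩
  have hmem : sInf K ∈ K := csInf_mem hK
  have : sInf {t | workload ω i A a t ≤ t} = workBelow ω i A a (sInf K) := by
    refine le_antisymm (sInf_le hmem) (le_sInf fun t ht => ?_)
    obtain ⟨k, h1, h2⟩ := exists_workBelow_le ht
    exact (workBelow_mono _ _ _ _ (sInf_le h1)).trans h2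
  rw [this]
  exact hmem

lemma duration_eq (M : Model N) (ω : Scenario N) (m : ℕ) (s : State N) :
    duration M ω m s =
      match (stagePeriod m : Period N) with
      | Period.switch j => (switchTime ω j m : ℝ≥0∞)
      | Period.visit j =>
        match M.discipline j with
        | Discipline.gated => work ω j (staying ω m s j)
        | Discipline.exhaustive =>
          sInf {t : ℝ≥0∞ | workload ω j (staying ω m s j) s.time t ≤ t} := rfl

/-- Two scenarios coincide as far as events up to time `t` and decisions before stage `m` are
concerned. -/
structure AgreeUpTo (t : ℝ≥0∞) (m : ℕ) (ω ω' : Scenario N) : Prop where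
  initial : ∀ i, initialLength ω i = initialLength ω' i
  service : ∀ i c, serviceTime ω i c = serviceTime ω' i c
  switch : ∀ j l, switchTime ω j l = switchTime ω' j l
  decision : ∀ i c l, l < m → wantsToLeave ω i c l = wantsToLeave ω' i c l
  epoch : ∀ i k, arrivalEpoch ω i k ≤ t ∨ arrivalEpoch ω' i k ≤ t →
    arrivalEpoch ω i k = arrivalEpoch ω' i k

namespace AgreeUpTo

variable {t : ℝ≥0∞} {m : ℕ} {ω ω' : Scenario N}

lemma mono (h : AgreeUpTo t m ω ω') {l : ℕ} (hl : l ≤ m) : AgreeUpTo t l ω ω' :=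
  { h with decision := fun i c k hk => h.decision i c k (hk.trans_le hl) }

lemma work_eq (h : AgreeUpTo t m ω ω') (i : Fin N) (A : Set Customer) :
    work ω i A = work ω' i A := by
  simp only [work, h.service]

lemma arrivals_eq (h : AgreeUpTo t m ω ω') (i : Fin N) (a : ℝ≥0∞) {b : ℝ≥0∞} (hb : b ≤ t) :
    arrivals ω i a b = arrivals ω' i a b := by
  ext c
  refine exists_congr fun k => and_congr_right fun _ => ?_
  constructor
  · rintro ⟨h1, h2⟩
    rw [← h.epoch i k (Or.inl (h2.trans hb))]
    exact ⟨h1, h2⟩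
  · rintro ⟨h1, h2⟩
    rw [h.epoch i k (Or.inr (h2.trans hb))]
    exact ⟨h1, h2⟩

lemma staying_eq (h : AgreeUpTo t (m + 1) ω ω') (s : State N) (i : Fin N) :
    staying ω m s i = staying ω' m s i := by
  ext c
  simp only [staying, Set.mem_ofPred_eq, h.decision i c m (Nat.lt_succ_self m)]

lemma workload_eq (h : AgreeUpTo t m ω ω') (i : Fin N) (A : Set Customer) {a u : ℝ≥0∞}
    (hu : a + u ≤ t) : workload ω i A a u = workload ω' i A a u := by
  rw [workload, workload, h.work_eq, h.work_eq, h.arrivals_eq i a hu]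

lemma duration_eq (M : Model N) (h : AgreeUpTo t (m + 1) ω ω') {s : State N}
    (hs : s.time + duration M ω m s ≤ t) : duration M ω' m s = duration M ω m s := by
  rw [Polling.duration_eq, Polling.duration_eq] at *
  split
  · exact congrArg _ (h.switch _ _).symm
  · rename_i j hj
    simp only [hj] at hs
    split
    · rw [h.work_eq, h.staying_eq]
    · rename_i hd
      simp only [hd] at hs
      rw [← h.staying_eq]
      set A := staying ω m s j
      have hmem := sInf_workload_mem ω j A s.time
      set d := sInf {t | workload ω j A s.time t ≤ t}
      refine le_antisymm (sInf_le ?_) (le_sInf fun u hu => ?_)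
      · change workload ω' j A s.time d ≤ d
        rw [← h.workload_eq j A hs]
        exact hmem
      · by_contra hlt
        rw [not_le] at hlt
        refine absurd (sInf_le ?_) (not_le.2 hlt)
        change workload ω j A s.time u ≤ u
        rw [h.workload_eq j A (le_trans (by gcongr) hs)]
        exact hu

lemma stateAt_eq (M : Model N) (h : AgreeUpTo t m ω ω') (hm : (stateAt M ω m).time ≤ t) :
    stateAt M ω' m = stateAt M ω m := by
  induction m with
  | zero => simp only [stateAt, h.initial]
  | succ m ih =>
    have hd : (stateAt M ω m).time + duration M ω m (stateAt M ω m) ≤ t := hm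
    have hs := ih (h.mono m.le_succ) (le_self_add.trans hd)
    have hdur := h.duration_eq M hd
    simp only [stateAt, hs, hdur, served, h.staying_eq, h.arrivals_eq _ _ hd]

end AgreeUpTo

lemma stateAt_succ_time (M : Model N) (ω : Scenario N) (m : ℕ) :
    (stateAt M ω (m + 1)).time = (stateAt M ω m).time + periodLength M ω m := rfl

lemma stateAt_time_mono (M : Model N) (ω : Scenario N) : Monotone fun m => (stateAt M ω m).time :=
  monotone_nat_of_le_succ fun m => by rw [stateAt_succ_time]; exact le_self_add

lemma stateAt_time_eq_sum (M : Model N) (ω : Scenario N) (m : ℕ) :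
    (stateAt M ω m).time = ∑ l ∈ Finset.range m, periodLength M ω l := by
  induction m with
  | zero => rfl
  | succ m ih => rw [stateAt_succ_time, ih, Finset.sum_range_succ]

lemma mem_waiting_succ (M : Model N) (ω : Scenario N) (m : ℕ) (i : Fin N) (c : Customer) :
    c ∈ (stateAt M ω (m + 1)).waiting i ↔
      (c ∈ staying ω m (stateAt M ω m) i ∨
        c ∈ arrivals ω i (stateAt M ω m).time (stateAt M ω (m + 1)).time) ∧
      c ∉ served M ω m (stateAt M ω m) i := Iff.rfl

lemma arrivalEpoch_le_of_mem_waiting (M : Model N) (ω : Scenario N) (i : Fin N) (k m : ℕ)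
    (h : Sum.inr k ∈ (stateAt M ω m).waiting i) :
    arrivalEpoch ω i k ≤ (stateAt M ω m).time := by
  induction m with
  | zero => simp [stateAt] at h
  | succ m ih =>
    rcases (mem_waiting_succ ..).1 h |>.1 with h | h
    · exact (ih h.1).trans (stateAt_time_mono M ω m.le_succ)
    · exact (inr_mem_arrivals.1 h).2

lemma inr_mem_waiting_succ_of_le {M : Model N} {ω : Scenario N} {i : Fin N} {k m : ℕ}
    (h : arrivalEpoch ω i k ≤ (stateAt M ω m).time) :
    Sum.inr k ∈ (stateAt M ω (m + 1)).waiting i ↔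
      Sum.inr k ∈ staying ω m (stateAt M ω m) i ∧
        Sum.inr k ∉ served M ω m (stateAt M ω m) i := by
  rw [mem_waiting_succ, inr_mem_arrivals]
  simp [not_lt.2 h]

lemma mem_served_iff (M : Model N) (ω : Scenario N) (m : ℕ) (i : Fin N) (c : Customer) :
    c ∈ served M ω m (stateAt M ω m) i ↔
      stagePeriod m = Period.visit i ∧ (stateAt M ω m).time < ⊤ ∧
      (c ∈ staying ω m (stateAt M ω m) i ∨ M.discipline i = Discipline.exhaustive ∧
        c ∈ arrivals ω i (stateAt M ω m).time (stateAt M ω (m + 1)).time) := Iff.rfl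

/-- A customer who arrives during stage `m` is served eventually iff served at once by an
exhaustive visit, or not reneging up to and including the next visit. -/
lemma inr_mem_eventuallyServed_iff {M : Model N} {ω : Scenario N} {i : Fin N} {k m m' : ℕ}
    (hfin : ∀ l, (stateAt M ω l).time < ⊤)
    (hk : Sum.inr k ∈ arrivals ω i (stateAt M ω m).time (stateAt M ω (m + 1)).time)
    (hm : m < m') (hvisit : (stagePeriod m' : Period N) = Period.visit i)
    (hbetween : ∀ l, m < l → l < m' → (stagePeriod l : Period N) ≠ Period.visit i) :
    Sum.inr k ∈ eventuallyServed M ω i ↔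
      ((stagePeriod m = Period.visit i ∧ M.discipline i = Discipline.exhaustive) ∨
        ∀ l ∈ Finset.Ioc m m', wantsToLeave ω i (Sum.inr k) l = false) := by
  have hk' := inr_mem_arrivals.1 hk
  -- The arrival epoch lies in the half-open window of stage `m`. Hence the customer is absent up to
  -- the start of stage `m`, and is no new arrival in any later stage.
  have hle : ∀ l, m < l → arrivalEpoch ω i k ≤ (stateAt M ω l).time := fun l hl =>
    hk'.2.trans (stateAt_time_mono M ω hl)
  have hnot : ∀ l ≤ m, Sum.inr k ∉ (stateAt M ω l).waiting i := fun l hl h =>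
    absurd ((arrivalEpoch_le_of_mem_waiting M ω i k l h).trans (stateAt_time_mono M ω hl))
      (not_le.2 hk'.1)
  have hserved_lt : ∀ l, l < m → Sum.inr k ∉ served M ω l (stateAt M ω l) i := fun l hl h => by
    rcases ((mem_served_iff ..).1 h).2.2 with h | h
    · exact hnot l hl.le h.1
    · exact absurd ((inr_mem_arrivals.1 h.2).2.trans (stateAt_time_mono M ω hl))
        (not_le.2 hk'.1)
  have hserved_gt : ∀ l, m < l → (Sum.inr k ∈ served M ω l (stateAt M ω l) i ↔
      stagePeriod l = Period.visit i ∧ Sum.inr k ∈ staying ω l (stateAt M ω l) i) := fun l hl => by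
    rw [mem_served_iff, inr_mem_arrivals]
    simp [hfin l, not_lt.2 (hle l hl)]
  by_cases hE : stagePeriod m = Period.visit i ∧ M.discipline i = Discipline.exhaustive
  · simp only [hE, true_and, true_or, iff_true]
    exact ⟨m, (mem_served_iff ..).2 ⟨hE.1, hfin m, Or.inr ⟨hE.2, hk⟩⟩⟩
  have hserved_m : Sum.inr k ∉ served M ω m (stateAt M ω m) i := fun h => by
    have h' := (mem_served_iff ..).1 h
    rcases h'.2.2 with h2 | h2
    · exact hnot m le_rfl h2.1
    · exact hE ⟨h'.1, h2.1⟩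
  -- No visit to queue `i` occurs strictly between `m` and `m'`, so reneging is the only way out.
  -- The decision at `l` itself is excluded, because `waiting` is recorded before the reneging at
  -- `l`.
  have hwait : ∀ l, m + 1 ≤ l → l ≤ m' → (Sum.inr k ∈ (stateAt M ω l).waiting i ↔
      ∀ j ∈ Finset.Ioo m l, wantsToLeave ω i (Sum.inr k) j = false) := by
    intro l hl
    induction l, hl using Nat.le_induction with
    | base =>
      intro _
      have : Sum.inr k ∈ (stateAt M ω (m + 1)).waiting i :=
        (mem_waiting_succ ..).2 ⟨Or.inr hk, hserved_m⟩
      simp only [this, true_iff, Finset.mem_Ioo]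
      intro j hj; lia
    | succ l hl ih =>
      intro hl'
      rw [inr_mem_waiting_succ_of_le (hle l hl), hserved_gt l hl]
      have h1 : (stagePeriod l : Period N) ≠ Period.visit i := hbetween l hl (by lia)
      simp only [h1, false_and, not_false_eq_true, and_true, staying, Set.mem_ofPred_eq,
        ih (by lia), Finset.mem_Ioo]
      constructor
      · rintro ⟨h2, h3⟩ j hj
        rcases eq_or_ne j l with rfl | hne
        · exact h3
        · exact h2 j ⟨hj.1, by lia⟩
      · intro h2
        exact ⟨fun j hj => h2 j ⟨hj.1, by lia⟩, h2 l ⟨hl, by lia⟩⟩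
  have hstay : Sum.inr k ∈ staying ω m' (stateAt M ω m') i ↔
      ∀ l ∈ Finset.Ioc m m', wantsToLeave ω i (Sum.inr k) l = false := by
    simp only [staying, Set.mem_ofPred_eq, hwait m' hm le_rfl, Finset.mem_Ioo, Finset.mem_Ioc]
    constructor
    · rintro ⟨h2, h3⟩ j hj
      rcases eq_or_ne j m' with rfl | hne
      · exact h3
      · exact h2 j ⟨hj.1, by lia⟩
    · intro h2
      exact ⟨fun j hj => h2 j ⟨hj.1, by lia⟩, h2 m' ⟨hm, le_rfl⟩⟩
  rw [← hstay]
  simp only [hE, false_or]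
  constructor
  · rintro ⟨l, hl⟩
    rcases lt_trichotomy l m with h | rfl | h
    · exact absurd hl (hserved_lt l h)
    · exact absurd hl hserved_m
    have hl' := (hserved_gt l h).1 hl
    rcases lt_trichotomy l m' with h2 | rfl | h2
    · exact absurd hl'.1 (hbetween l h h2)
    · exact hl'.2
    · exfalso
      -- Whoever is still waiting at stage `m'` either reneges or is served there, and nobody
      -- rejoins a queue.
      have hw : ∀ j, m' + 1 ≤ j → Sum.inr k ∉ (stateAt M ω j).waiting i := by
        intro j hj
        induction j, hj using Nat.le_induction with
        | base =>
          rw [inr_mem_waiting_succ_of_le (hle m' hm), hserved_gt m' hm]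
          tauto
        | succ j hj ih =>
          rw [inr_mem_waiting_succ_of_le (hle j (by lia))]
          exact fun h => ih h.1.1
      exact hw l h2 hl'.2.1
  · exact fun h => ⟨m', (hserved_gt m' hm).2 ⟨hvisit, h⟩⟩

end Paths

/-! ### Measurability of the dynamics -/

section Measurability

variable {N : ℕ} [NeZero N]

@[fun_prop]
lemma measurable_interarrival (i : Fin N) (k : ℕ) :
    Measurable fun ω : Scenario N => interarrival ω i k := by
  unfold interarrival; fun_prop

@[fun_prop]
lemma measurable_serviceTime (i : Fin N) (c : Customer) :
    Measurable fun ω : Scenario N => serviceTime ω i c := by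
  unfold serviceTime; fun_prop

@[fun_prop]
lemma measurable_switchTime (j : Fin N) (m : ℕ) :
    Measurable fun ω : Scenario N => switchTime ω j m := by
  unfold switchTime; fun_prop

@[fun_prop]
lemma measurable_wantsToLeave (i : Fin N) (c : Customer) (m : ℕ) :
    Measurable fun ω : Scenario N => wantsToLeave ω i c m := by
  unfold wantsToLeave; fun_prop

@[fun_prop]
lemma measurable_arrivalEpoch (i : Fin N) (k : ℕ) :
    Measurable fun ω : Scenario N => arrivalEpoch ω i k := by
  unfold arrivalEpoch; fun_prop

/-- A random set of customers is measurable if membership of each customer is an event. -/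
def MeasurableCustomers (A : Scenario N → Set Customer) : Prop :=
  ∀ c, MeasurableSet {ω | c ∈ A ω}

lemma MeasurableCustomers.work {A : Scenario N → Set Customer} (hA : MeasurableCustomers A)
    (i : Fin N) : Measurable fun ω => work ω i (A ω) := by
  classical
  have : (fun ω => Polling.work ω i (A ω)) =
      fun ω => ∑' c, if c ∈ A ω then (serviceTime ω i c : ℝ≥0∞) else 0 := by
    ext ω
    exact tsum_subtype (A ω) fun c => (serviceTime ω i c : ℝ≥0∞)
  rw [this]
  exact Measurable.tsum fun c => Measurable.ite (hA c) (by fun_prop) measurable_const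

lemma MeasurableCustomers.arrivals (i : Fin N) {a b : Scenario N → ℝ≥0∞} (ha : Measurable a)
    (hb : Measurable b) : MeasurableCustomers fun ω => arrivals ω i (a ω) (b ω) := by
  rintro (k | k)
  · simp only [inl_notMem_arrivals]
    exact MeasurableSet.empty
  · simp only [inr_mem_arrivals]
    exact (measurableSet_lt ha (by fun_prop)).inter (measurableSet_le (by fun_prop) hb)

lemma MeasurableCustomers.arrivalsBelow (i : Fin N) {a : Scenario N → ℝ≥0∞} (ha : Measurable a)
    (k : ℕ∞) : MeasurableCustomers fun ω => arrivalsBelow ω i (a ω) k := by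
  rintro (l | l)
  · simp [Polling.arrivalsBelow]
  · simp only [Polling.arrivalsBelow, Set.mem_ofPred_eq, Sum.inr.injEq, exists_eq_left']
    exact (MeasurableSet.const _).inter (measurableSet_lt ha (by fun_prop))

/-- The infimum over uncountably many times reduces to one over the countable family of candidates
indexed by `ℕ∞`. -/
lemma MeasurableCustomers.sInf_workload (i : Fin N) {A : Scenario N → Set Customer}
    (hA : MeasurableCustomers A) {a : Scenario N → ℝ≥0∞} (ha : Measurable a) :
    Measurable fun ω => sInf {t | workload ω i (A ω) (a ω) t ≤ t} := by
  classical
  simp_rw [sInf_workload_eq_iInf]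
  refine Measurable.iInf fun k => ?_
  have h1 : Measurable fun ω => workBelow ω i (A ω) (a ω) k :=
    (hA.work i).add ((MeasurableCustomers.arrivalsBelow i ha k).work i)
  have h2 : Measurable fun ω => workload ω i (A ω) (a ω) (workBelow ω i (A ω) (a ω) k) :=
    (hA.work i).add ((MeasurableCustomers.arrivals i ha (ha.add h1)).work i)
  exact Measurable.ite (measurableSet_le h2 h1) h1 measurable_const

lemma MeasurableCustomers.staying {s : Scenario N → State N} {i : Fin N}
    (h : MeasurableCustomers fun ω => (s ω).waiting i) (m : ℕ) :
    MeasurableCustomers fun ω => staying ω m (s ω) i := fun c =>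
  (h c).inter (measurableSet_eq_fun (by fun_prop) measurable_const)

lemma measurable_duration (M : Model N) {s : Scenario N → State N}
    (ht : Measurable fun ω => (s ω).time)
    (hw : ∀ i, MeasurableCustomers fun ω => (s ω).waiting i) (m : ℕ) :
    Measurable fun ω => duration M ω m (s ω) := by
  simp_rw [duration_eq]
  split
  · fun_prop
  · split
    · exact ((hw _).staying m).work _
    · exact MeasurableCustomers.sInf_workload _ ((hw _).staying m) ht

lemma measurable_stateAt (M : Model N) (m : ℕ) :
    (Measurable fun ω => (stateAt M ω m).time) ∧
      ∀ i, MeasurableCustomers fun ω => (stateAt M ω m).waiting i := by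
  induction m with
  | zero =>
    refine ⟨measurable_const, fun i c => ?_⟩
    rcases c with k | k
    · simp only [stateAt, Set.mem_ofPred_eq, Sum.inl.injEq, exists_eq_right']
      have : Measurable fun ω : Scenario N => initialLength ω i := by
        unfold initialLength; fun_prop
      exact measurableSet_lt measurable_const this
    · simp [stateAt]
  | succ m ih =>
    have hd := measurable_duration M ih.1 ih.2 m
    have ht : Measurable fun ω => (stateAt M ω (m + 1)).time := ih.1.add hd
    refine ⟨ht, fun i c => ?_⟩
    have hs := (ih.2 i).staying m c
    have ha := MeasurableCustomers.arrivals i ih.1 ht c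
    simp only [mem_waiting_succ, mem_served_iff]
    exact (hs.union ha).inter ((MeasurableSet.const _).inter
      ((measurableSet_lt ih.1 measurable_const).inter
        (hs.union ((MeasurableSet.const _).inter ha)))).compl

@[fun_prop]
lemma measurable_stateAt_time (M : Model N) (m : ℕ) :
    Measurable fun ω => (stateAt M ω m).time := (measurable_stateAt M m).1

@[fun_prop]
lemma measurable_periodLength (M : Model N) (m : ℕ) :
    Measurable fun ω => periodLength M ω m :=
  measurable_duration M (measurable_stateAt M m).1 (measurable_stateAt M m).2 m

end Measurability

/-! ### Nonanticipating times and Wald's identity -/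

section Wald

variable {N : ℕ} [NeZero N]

/-- Time of the last type `i` arrival with index below `k` (`0` if `k = 0`). -/
noncomputable def previousEpoch (ω : Scenario N) (i : Fin N) (k : ℕ) : ℝ≥0∞ :=
  ∑ l ∈ Finset.range k, ENNReal.ofReal (interarrival ω i l)

@[fun_prop]
lemma measurable_previousEpoch (i : Fin N) (k : ℕ) :
    Measurable fun ω : Scenario N => previousEpoch ω i k := by
  unfold previousEpoch; fun_prop

lemma previousEpoch_lt_top (ω : Scenario N) (i : Fin N) (k : ℕ) : previousEpoch ω i k < ⊤ :=
  ENNReal.sum_lt_top.2 fun _ _ => ENNReal.ofReal_lt_top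

lemma previousEpoch_mono (ω : Scenario N) (i : Fin N) : Monotone (previousEpoch ω i) :=
  fun _ _ h => Finset.sum_le_sum_of_subset (Finset.range_mono h)

lemma interarrival_setInterarrival_of_ne (ω : Scenario N) (i : Fin N) (k : ℕ) (x : ℝ) {j : Fin N}
    {l : ℕ} (h : (j, l) ≠ (i, k)) :
    interarrival (setInterarrival ω i k x) j l = interarrival ω j l :=
  Function.update_of_ne h _ _

lemma interarrival_setInterarrival_self (ω : Scenario N) (i : Fin N) (k : ℕ) (x : ℝ) :
    interarrival (setInterarrival ω i k x) i k = x :=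
  Function.update_self (β := fun _ => ℝ) (i, k) x ω.2.1

lemma arrivalEpoch_setInterarrival_of_lt (ω : Scenario N) (i : Fin N) (k : ℕ) (x : ℝ) {j : Fin N}
    {l : ℕ} (h : j ≠ i ∨ l < k) :
    arrivalEpoch (setInterarrival ω i k x) j l = arrivalEpoch ω j l := by
  refine Finset.sum_congr rfl fun l' hl' => ?_
  rw [interarrival_setInterarrival_of_ne]
  rw [Finset.mem_range] at hl'
  rintro ⟨⟩
  rcases h with h | h
  · exact h rfl
  · lia

lemma previousEpoch_setInterarrival (ω : Scenario N) (i : Fin N) (k : ℕ) (x : ℝ) :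
    previousEpoch (setInterarrival ω i k x) i k = previousEpoch ω i k := by
  refine Finset.sum_congr rfl fun l hl => ?_
  rw [interarrival_setInterarrival_of_ne]
  rw [Finset.mem_range] at hl
  rintro ⟨⟩
  lia

lemma arrivalEpoch_setInterarrival_self (ω : Scenario N) (i : Fin N) (k : ℕ) (x : ℝ) :
    arrivalEpoch (setInterarrival ω i k x) i k = previousEpoch ω i k + ENNReal.ofReal x := by
  rw [← previousEpoch_setInterarrival ω i k x, arrivalEpoch, Finset.sum_range_succ,
    interarrival_setInterarrival_self]
  rfl

/-- A random time is nonanticipating for the type `i` arrivals if, as long as it precedes an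
arrival, it does not depend on when that arrival takes place. -/
def Nonanticipating (i : Fin N) (T : Scenario N → ℝ≥0∞) : Prop :=
  ∀ ω k x y, T (setInterarrival ω i k x) < arrivalEpoch (setInterarrival ω i k x) i k →
    T (setInterarrival ω i k x) < arrivalEpoch (setInterarrival ω i k y) i k →
    T (setInterarrival ω i k y) = T (setInterarrival ω i k x)

/-- Altering the `k`-th interarrival time moves only the arrivals of type `i` from the `k`-th on. In
both scenarios these come strictly after the stage time, so the two agree up to it. -/
lemma nonanticipating_stateAt_time (M : Model N) (i : Fin N) (m : ℕ) :
    Nonanticipating i fun ω => (stateAt M ω m).time := by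
  intro ω k x y hx hy
  refine congrArg State.time (AgreeUpTo.stateAt_eq M (t :=
    (stateAt M (setInterarrival ω i k x) m).time) ⟨?_, ?_, ?_, ?_, ?_⟩ le_rfl)
  · exact fun _ => rfl
  · exact fun _ _ => rfl
  · exact fun _ _ => rfl
  · exact fun _ _ _ _ => rfl
  · intro j l hl
    by_cases h : j ≠ i ∨ l < k
    · rw [arrivalEpoch_setInterarrival_of_lt _ _ _ _ h,
        arrivalEpoch_setInterarrival_of_lt _ _ _ _ h]
    · push Not at h
      obtain ⟨rfl, h⟩ := h
      exfalso
      rcases hl with hl | hl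
      · exact absurd (hx.trans_le (arrivalEpoch_mono _ _ h)) (not_lt.2 hl)
      · exact absurd (hy.trans_le (arrivalEpoch_mono _ _ h)) (not_lt.2 hl)

/-- A stopping rule for a single exponential clock started at time `a`. -/
lemma rate_mul_lintegral_min_clock {r : ℝ} (hr : 0 < r) {a : ℝ≥0∞} (ha : a < ⊤) (g : ℝ → ℝ≥0∞)
    (hg : ∀ x y, g x < a + ENNReal.ofReal x → g x < a + ENNReal.ofReal y → g y = g x) :
    ENNReal.ofReal r * ∫⁻ x, min (g x) (a + ENNReal.ofReal x) ∂(expMeasure r) =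
      ENNReal.ofReal r * ∫⁻ x, min (g x) a ∂(expMeasure r) +
        expMeasure r {x | a + ENNReal.ofReal x ≤ g x} := by
  have := isProbabilityMeasure_expMeasure hr
  -- Until the clock rings, the rule `g` cannot know when it will ring, so it acts as one fixed
  -- deadline `u`. This is its value at any `x` where it stops before the ring, or `⊤` if there is
  -- no such `x`.
  obtain ⟨u, hu⟩ : ∃ u, ∀ x, min (g x) (a + ENNReal.ofReal x) = min u (a + ENNReal.ofReal x) := by
    by_cases h : ∃ x, g x < a + ENNReal.ofReal x
    · obtain ⟨x, hx⟩ := h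
      refine ⟨g x, fun y => ?_⟩
      by_cases hy : g x < a + ENNReal.ofReal y
      · rw [hg x y hx hy]
      · rw [not_lt] at hy
        rw [min_eq_right hy, min_eq_right]
        by_contra hlt
        rw [not_le] at hlt
        exact absurd (hg y x hlt ((hlt.trans_le hy).trans hx)) (hlt.trans_le hy).ne'
    · push Not at h
      exact ⟨⊤, fun x => by rw [min_eq_right (h x), min_eq_right le_top]⟩
  have h1 : ∀ x, min (g x) a = min u a := fun x => by
    have : ∀ v, min v a = min (min v (a + ENNReal.ofReal x)) a := fun v => by
      rw [min_assoc, min_eq_right (le_self_add : a ≤ a + ENNReal.ofReal x)]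
    rw [this, hu, ← this]
  have h2 : ∀ x, a + ENNReal.ofReal x ≤ g x ↔ a + ENNReal.ofReal x ≤ u := fun x => by
    rw [← min_eq_right_iff, hu, min_eq_right_iff]
  have h3 : ∀ x, min u (a + ENNReal.ofReal x) = min u a + min (ENNReal.ofReal x) (u - a) := by
    intro x
    rcases le_total u a with h | h
    · rw [min_eq_left (h.trans le_self_add), min_eq_left h, tsub_eq_zero_of_le h]
      simp
    · rw [min_eq_right h, ← min_add_add_left, add_tsub_cancel_of_le h, min_comm]
  simp_rw [hu, h1, h2, h3]
  rw [lintegral_add_left measurable_const, mul_add, rate_mul_lintegral_min_expMeasure hr]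
  congr 1
  apply measure_congr
  have h0 : ∀ᵐ x ∂(expMeasure r), x ∉ Set.Iic (0 : ℝ) :=
    measure_eq_zero_iff_ae_notMem.1 (expMeasure_Iic_zero hr)
  filter_upwards [h0] with x hx
  apply propext
  change ENNReal.ofReal x ≤ u - a ↔ a + ENNReal.ofReal x ≤ u
  rw [Set.mem_Iic, not_le] at hx
  have hx' : 0 < ENNReal.ofReal x := ENNReal.ofReal_pos.2 hx
  constructor
  · intro h
    have hau : a ≤ u := by
      by_contra hlt
      rw [tsub_eq_zero_of_le (not_le.1 hlt).le] at h
      exact absurd hx' (not_lt.2 h)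
    calc a + ENNReal.ofReal x ≤ a + (u - a) := by gcongr
      _ = u := add_tsub_cancel_of_le hau
  · exact fun h => ENNReal.le_sub_of_add_le_left ha.ne h

variable (M : Model N) (π : ProbabilityMeasure (Fin N → ℕ))

lemma rate_mul_lintegral_min_arrivalEpoch {i : Fin N} {T : Scenario N → ℝ≥0∞}
    (hT : Measurable T) (hna : Nonanticipating i T) (k : ℕ) :
    ENNReal.ofReal (M.rate i) * ∫⁻ ω, min (T ω) (arrivalEpoch ω i k) ∂(law M π) =
      ENNReal.ofReal (M.rate i) * ∫⁻ ω, min (T ω) (previousEpoch ω i k) ∂(law M π) +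
        law M π {ω | arrivalEpoch ω i k ≤ T ω} := by
  have hS : MeasurableSet {ω | arrivalEpoch ω i k ≤ T ω} := measurableSet_le (by fun_prop) hT
  have hset := (measurePreserving_setInterarrival M π i k).measurable
  rw [← lintegral_indicator_one hS,
    lintegral_law_setInterarrival M π i k (F := fun ω => min (T ω) (arrivalEpoch ω i k))
      (by fun_prop),
    lintegral_law_setInterarrival M π i k (F := fun ω => min (T ω) (previousEpoch ω i k))
      (by fun_prop),
    lintegral_law_setInterarrival M π i k (measurable_one.indicator hS),
    ← lintegral_const_mul' _ _ ENNReal.ofReal_ne_top,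
    ← lintegral_const_mul' _ _ ENNReal.ofReal_ne_top, ← lintegral_add_left]
  -- With all other data frozen, the `k`-th clock is a single exponential clock started at
  -- `previousEpoch ω i k`.
  · refine lintegral_congr fun ω => ?_
    simp_rw [arrivalEpoch_setInterarrival_self, previousEpoch_setInterarrival]
    rw [rate_mul_lintegral_min_clock (M.rate_pos i) (previousEpoch_lt_top ω i k)
      (fun x => T (setInterarrival ω i k x))]
    · congr 1
      have hm : MeasurableSet {x | previousEpoch ω i k + ENNReal.ofReal x ≤
          T (setInterarrival ω i k x)} :=
        measurableSet_le (by fun_prop) (hT.comp (hset.comp measurable_prodMk_left))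
      rw [← lintegral_indicator_one hm]
      refine lintegral_congr fun x => ?_
      simp [Set.indicator_apply, arrivalEpoch_setInterarrival_self]
    · intro x y hx hy
      refine hna ω k x y ?_ ?_ <;> rwa [arrivalEpoch_setInterarrival_self]
  · refine Measurable.const_mul ?_ _
    refine Measurable.lintegral_prod_right' (f := fun p : Scenario N × ℝ =>
      min (T (setInterarrival p.1 i k p.2)) (previousEpoch (setInterarrival p.1 i k p.2) i k)) ?_
    exact (hT.comp hset).min ((measurable_previousEpoch i k).comp hset)

lemma rate_mul_lintegral_min_previousEpoch {i : Fin N} {T : Scenario N → ℝ≥0∞}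
    (hT : Measurable T) (hna : Nonanticipating i T) (n : ℕ) :
    ENNReal.ofReal (M.rate i) * ∫⁻ ω, min (T ω) (previousEpoch ω i n) ∂(law M π) =
      ∑ k ∈ Finset.range n, law M π {ω | arrivalEpoch ω i k ≤ T ω} := by
  induction n with
  | zero => simp [previousEpoch]
  | succ n ih =>
    rw [Finset.sum_range_succ, ← ih, ← rate_mul_lintegral_min_arrivalEpoch M π hT hna]
    rfl

lemma ae_iSup_previousEpoch (i : Fin N) : ∀ᵐ ω ∂(law M π), ⨆ n, previousEpoch ω i n = ⊤ := by
  have key : ∀ t : ℕ, ∀ᵐ ω ∂(law M π), (t : ℝ≥0∞) ≤ ⨆ n, previousEpoch ω i n := by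
    intro t
    -- Borel–Cantelli: the constant time `t` is nonanticipating, so the probabilities sum to at most
    -- `λ_i t` and almost surely some epoch exceeds `t`.
    have hsum : ∑' k, law M π {ω | arrivalEpoch ω i k ≤ t} ≠ ⊤ := by
      refine ne_top_of_le_ne_top (b := ENNReal.ofReal (M.rate i) * t)
        (ENNReal.mul_ne_top ENNReal.ofReal_ne_top (ENNReal.natCast_ne_top t)) ?_
      refine ENNReal.tsum_le_of_sum_range_le fun n => ?_
      rw [← rate_mul_lintegral_min_previousEpoch M π (T := fun _ => (t : ℝ≥0∞)) measurable_const
        (fun _ _ _ _ _ _ => rfl)]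
      gcongr
      calc ∫⁻ ω, min (t : ℝ≥0∞) (previousEpoch ω i n) ∂(law M π) ≤ ∫⁻ _, (t : ℝ≥0∞) ∂(law M π) :=
            lintegral_mono fun _ => min_le_left _ _
        _ = t := by simp
    filter_upwards [ae_eventually_notMem hsum] with ω hω
    obtain ⟨k, hk⟩ := hω.exists
    have hk' : (t : ℝ≥0∞) < arrivalEpoch ω i k := not_le.1 hk
    exact hk'.le.trans (le_iSup (previousEpoch ω i) (k + 1))
  filter_upwards [ae_all_iff.2 key] with ω hω
  exact ENNReal.eq_top_of_forall_nnreal_le fun r => by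
    obtain ⟨n, hn⟩ := exists_nat_ge r
    exact le_trans (by exact_mod_cast hn) (hω n)

/-- Wald's identity: the expected number of type `i` arrivals up to a nonanticipating time. -/
lemma tsum_law_arrivalEpoch_le {i : Fin N} {T : Scenario N → ℝ≥0∞}
    (hT : Measurable T) (hna : Nonanticipating i T) :
    ∑' k, law M π {ω | arrivalEpoch ω i k ≤ T ω} =
      ENNReal.ofReal (M.rate i) * ∫⁻ ω, T ω ∂(law M π) := by
  -- Monotone convergence. Truncation at the epochs loses nothing in the limit because they almost
  -- surely tend to infinity.
  have h1 : ∫⁻ ω, T ω ∂(law M π) = ⨆ n, ∫⁻ ω, min (T ω) (previousEpoch ω i n) ∂(law M π) := by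
    rw [← lintegral_iSup (f := fun n ω => min (T ω) (previousEpoch ω i n)) (fun n => by fun_prop)
      (fun a b h ω => min_le_min_left _ (previousEpoch_mono ω i h))]
    refine lintegral_congr_ae ?_
    filter_upwards [ae_iSup_previousEpoch M π i] with ω hω
    rw [← inf_iSup_eq, hω, inf_top_eq]
  rw [h1, ENNReal.mul_iSup, ENNReal.tsum_eq_iSup_nat]
  simp_rw [rate_mul_lintegral_min_previousEpoch M π hT hna]

end Wald

/-! ### Independent thinning by the reneging decisions -/

section Thinning

variable {N : ℕ} [NeZero N] (M : Model N) (π : ProbabilityMeasure (Fin N → ℕ))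

lemma stayProb_nonneg (i : Fin N) (P : Period N) : 0 ≤ stayProb M i P :=
  sub_nonneg.2 (M.renege i P).2.2

lemma wantsToLeave_setDecision_of_ne (ω : Scenario N) (d : Fin N × Customer × ℕ) (b : Bool)
    {i : Fin N} {c : Customer} {l : ℕ} (h : (i, c, l) ≠ d) :
    wantsToLeave (setDecision ω d b) i c l = wantsToLeave ω i c l :=
  Function.update_of_ne h _ _

lemma wantsToLeave_setDecision_self (ω : Scenario N) (i : Fin N) (c : Customer) (l : ℕ)
    (b : Bool) : wantsToLeave (setDecision ω (i, c, l) b) i c l = b :=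
  Function.update_self (β := fun _ => Bool) (i, c, l) b ω.2.2.2.2

lemma stateAt_setDecision (ω : Scenario N) (i : Fin N) (c : Customer) {l m : ℕ} (hl : m ≤ l)
    (b : Bool) : stateAt M (setDecision ω (i, c, l) b) m = stateAt M ω m := by
  refine AgreeUpTo.stateAt_eq M (t := ⊤) ⟨fun _ => rfl, fun _ _ => rfl, fun _ _ => rfl, ?_,
    fun _ _ _ => rfl⟩ le_top
  intro j c' l' hl'
  rw [wantsToLeave_setDecision_of_ne]
  rintro ⟨⟩
  lia

/-- Resampling the decision leaves `E` unchanged by `hinv`, so the inner integral contributes only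
the Bernoulli probability of staying. -/
lemma law_inter_stay {E : Set (Scenario N)} (hE : MeasurableSet E) (i : Fin N) (c : Customer)
    (l : ℕ) (hinv : ∀ ω b, setDecision ω (i, c, l) b ∈ E ↔ ω ∈ E) :
    law M π (E ∩ {ω | wantsToLeave ω i c l = false}) =
      law M π E * ENNReal.ofReal (stayProb M i (stagePeriod l)) := by
  have hF : MeasurableSet {ω : Scenario N | wantsToLeave ω i c l = false} :=
    measurableSet_eq_fun (by fun_prop) measurable_const
  rw [← lintegral_indicator_one (hE.inter hF),
    lintegral_law_setDecision M π (i, c, l) (measurable_one.indicator (hE.inter hF)),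
    ← lintegral_indicator_one hE, ← lintegral_mul_const' _ _ ENNReal.ofReal_ne_top]
  refine lintegral_congr fun ω => ?_
  rw [stayProb, ← bernoulliMeasure_false, ← lintegral_indicator_one (measurableSet_singleton _),
    ← lintegral_const_mul _ (measurable_one.indicator (measurableSet_singleton _))]
  refine lintegral_congr fun b => ?_
  have h : setDecision ω (i, c, l) b ∈ E ∩ {ω | wantsToLeave ω i c l = false} ↔
      ω ∈ E ∧ b = false := by
    refine and_congr (hinv ω b) ?_
    change wantsToLeave _ _ _ _ = false ↔ _
    rw [wantsToLeave_setDecision_self]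
  by_cases h1 : ω ∈ E
  · by_cases h2 : b = false
    · rw [Set.indicator_of_mem (h.2 ⟨h1, h2⟩)]
      simp [h1, h2]
    · rw [Set.indicator_of_notMem (fun h' => h2 (h.1 h').2)]
      simp [h2]
  · rw [Set.indicator_of_notMem (fun h' => h1 (h.1 h').1)]
    simp [h1]

lemma law_inter_forall_stay {E : Set (Scenario N)} (hE : MeasurableSet E) (i : Fin N)
    (c : Customer) {m m' : ℕ} (hm : m ≤ m')
    (hinv : ∀ l, m < l → ∀ ω b, setDecision ω (i, c, l) b ∈ E ↔ ω ∈ E) :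
    law M π (E ∩ {ω | ∀ l ∈ Finset.Ioc m m', wantsToLeave ω i c l = false}) =
      law M π E * ENNReal.ofReal (∏ l ∈ Finset.Ioc m m', stayProb M i (stagePeriod l)) := by
  induction m', hm using Nat.le_induction with
  | base => simp
  | succ m' hm ih =>
    have hset : E ∩ {ω | ∀ l ∈ Finset.Ioc m (m' + 1), wantsToLeave ω i c l = false} =
        (E ∩ {ω | ∀ l ∈ Finset.Ioc m m', wantsToLeave ω i c l = false}) ∩
          {ω | wantsToLeave ω i c (m' + 1) = false} := by
      rw [Set.inter_assoc]
      congr 1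
      ext ω
      simp only [← Finset.insert_Ioc_right_eq_Ioc_add_one hm, Finset.forall_mem_insert,
        Set.mem_inter_iff, Set.mem_ofPred_eq, and_comm]
    rw [hset, law_inter_stay, ih, mul_assoc, ← ENNReal.ofReal_mul
      (Finset.prod_nonneg fun l _ => stayProb_nonneg M i _), Finset.prod_Ioc_succ_top hm]
    · refine hE.inter ?_
      have : {ω : Scenario N | ∀ l ∈ Finset.Ioc m m', wantsToLeave ω i c l = false} =
          ⋂ l ∈ Finset.Ioc m m', {ω | wantsToLeave ω i c l = false} := by
        ext ω; simp
      rw [this]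
      exact Finset.measurableSet_biInter _ fun l _ =>
        measurableSet_eq_fun (by fun_prop) measurable_const
    -- The decision at stage `m' + 1` affects neither `E` nor the decisions at the stages up to
    -- `m'`.
    · intro ω b
      simp only [Set.mem_inter_iff, hinv _ (Nat.lt_succ_of_le hm), Set.mem_ofPred_eq]
      refine and_congr_right fun _ => forall₂_congr fun l hl => ?_
      rw [wantsToLeave_setDecision_of_ne]
      rw [Finset.mem_Ioc] at hl
      rintro ⟨⟩
      lia

/-- The type `i` customers who arrive during the stages `a, …, b - 1`. -/
def stageArrivals (ω : Scenario N) (i : Fin N) (a b : ℕ) : Set Customer :=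
  arrivals ω i (stateAt M ω a).time (stateAt M ω b).time

lemma measurableCustomers_stageArrivals (i : Fin N) (a b : ℕ) :
    MeasurableCustomers fun ω => stageArrivals M ω i a b :=
  MeasurableCustomers.arrivals i (by fun_prop) (by fun_prop)

lemma measurableCustomers_eventuallyServed (i : Fin N) :
    MeasurableCustomers fun ω => eventuallyServed M ω i := by
  intro c
  have : {ω | c ∈ eventuallyServed M ω i} = ⋃ m, {ω | c ∈ served M ω m (stateAt M ω m) i} := by
    ext ω; simp [eventuallyServed]
  rw [this]
  refine MeasurableSet.iUnion fun m => ?_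
  simp only [mem_served_iff]
  exact (MeasurableSet.const _).inter ((measurableSet_lt
    (measurable_stateAt_time M m) measurable_const).inter ((((measurable_stateAt M m).2 i).staying m c).union ((MeasurableSet.const _).inter
      (measurableCustomers_stageArrivals M i m (m + 1) c))))

/-- The half-open windows of successive stages tile the whole window, so each arrival belongs to
exactly one stage. -/
lemma law_stageArrivals_inter_eq_sum (i : Fin N) (k : ℕ) (E : Set (Scenario N)) {a b : ℕ}
    (hab : a ≤ b) :
    law M π ({ω | Sum.inr k ∈ stageArrivals M ω i a b} ∩ E) =
      ∑ m ∈ Finset.Ico a b, law M π ({ω | Sum.inr k ∈ stageArrivals M ω i m (m + 1)} ∩ E) := by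
  induction b, hab using Nat.le_induction with
  | base =>
    have : {ω | Sum.inr k ∈ stageArrivals M ω i a a} = ∅ := by
      ext ω
      simp only [stageArrivals, inr_mem_arrivals, Set.mem_ofPred_eq, Set.mem_empty_iff_false,
        iff_false, not_and]
      exact fun h => not_le.2 h
    simp [this]
  | succ b hb ih =>
    rw [Finset.sum_Ico_succ_top hb, ← ih, ← measure_inter_add_sdiff
      ({ω | Sum.inr k ∈ stageArrivals M ω i a (b + 1)} ∩ E)
      (measurableCustomers_stageArrivals M i a b (Sum.inr k))]
    have h1 : ∀ ω, (stateAt M ω a).time ≤ (stateAt M ω b).time := fun ω =>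
      stateAt_time_mono M ω hb
    have h2 : ∀ ω, (stateAt M ω b).time ≤ (stateAt M ω (b + 1)).time := fun ω =>
      stateAt_time_mono M ω b.le_succ
    congr 2
    · ext ω
      simp only [stageArrivals, inr_mem_arrivals, Set.mem_inter_iff, Set.mem_ofPred_eq]
      have := h2 ω
      constructor
      · tauto
      · rintro ⟨⟨h3, h4⟩, h5⟩
        exact ⟨⟨⟨h3, h4.trans this⟩, h5⟩, h3, h4⟩
    · ext ω
      simp only [stageArrivals, inr_mem_arrivals, Set.mem_inter_iff, Set.mem_ofPred_eq,
        Set.mem_sdiff, not_and, not_le]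
      have := h1 ω
      constructor
      · rintro ⟨⟨⟨h3, h4⟩, h5⟩, h6⟩
        exact ⟨⟨h6 h3, h4⟩, h5⟩
      · rintro ⟨⟨h3, h4⟩, h5⟩
        exact ⟨⟨⟨this.trans_lt h3, h4⟩, h5⟩, fun _ => h3⟩

/-- Difference of Wald's identity at the two ends of the stage. The cancellation in `ℝ≥0∞` is
legitimate since `hfin` makes the subtracted term finite. -/
lemma tsum_law_stageArrivals (i : Fin N) (m : ℕ)
    (hfin : ∫⁻ ω, (stateAt M ω m).time ∂(law M π) ≠ ⊤) :
    ∑' k, law M π {ω | Sum.inr k ∈ stageArrivals M ω i m (m + 1)} =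
      ENNReal.ofReal (M.rate i) * ∫⁻ ω, periodLength M ω m ∂(law M π) := by
  have hW := fun m => tsum_law_arrivalEpoch_le M π (i := i) (T := fun ω => (stateAt M ω m).time)
    (by fun_prop) (nonanticipating_stateAt_time M i m)
  have hsplit : ∀ k, law M π {ω | arrivalEpoch ω i k ≤ (stateAt M ω (m + 1)).time} =
      law M π {ω | arrivalEpoch ω i k ≤ (stateAt M ω m).time} +
        law M π {ω | Sum.inr k ∈ stageArrivals M ω i m (m + 1)} := by
    intro k
    rw [← measure_inter_add_sdiff {ω | arrivalEpoch ω i k ≤ (stateAt M ω (m + 1)).time}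
      (measurableSet_le (by fun_prop) (by fun_prop) :
        MeasurableSet {ω | arrivalEpoch ω i k ≤ (stateAt M ω m).time})]
    congr 2
    · ext ω
      exact ⟨fun h => h.2, fun h => ⟨le_trans h (stateAt_time_mono M ω m.le_succ), h⟩⟩
    · ext ω
      simp only [stageArrivals, inr_mem_arrivals, Set.mem_sdiff, Set.mem_ofPred_eq, not_le,
        and_comm]
  have h2 := hW (m + 1)
  simp_rw [hsplit] at h2
  rw [ENNReal.tsum_add, hW m] at h2
  simp_rw [stateAt_succ_time] at h2
  rw [lintegral_add_left (by fun_prop), mul_add] at h2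
  exact (ENNReal.add_right_inj (ENNReal.mul_ne_top ENNReal.ofReal_ne_top hfin)).1 h2

/-- Expected number of customers who arrive during stage `m`, not at an exhaustive visit to their
own queue, and are served eventually. -/
lemma tsum_law_stageArrivals_served {i : Fin N} {m m' : ℕ}
    (hT : ∫⁻ ω, (stateAt M ω m).time ∂(law M π) ≠ ⊤)
    (hfin : ∀ᵐ ω ∂(law M π), ∀ l, (stateAt M ω l).time < ⊤)
    (hE : ¬ ((stagePeriod m : Period N) = Period.visit i ∧
      M.discipline i = Discipline.exhaustive))
    (hm : m < m') (hvisit : (stagePeriod m' : Period N) = Period.visit i)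
    (hbetween : ∀ l, m < l → l < m' → (stagePeriod l : Period N) ≠ Period.visit i) :
    ∑' k, law M π ({ω | Sum.inr k ∈ stageArrivals M ω i m (m + 1)} ∩
        {ω | Sum.inr k ∈ eventuallyServed M ω i}) =
      ENNReal.ofReal (M.rate i * ∏ l ∈ Finset.Ioc m m', stayProb M i (stagePeriod l)) *
        ∫⁻ ω, periodLength M ω m ∂(law M π) := by
  rw [ENNReal.ofReal_mul (M.rate_pos i).le, mul_right_comm, ← tsum_law_stageArrivals M π i m hT,
    ← ENNReal.tsum_mul_right]
  refine tsum_congr fun k => ?_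
  rw [← law_inter_forall_stay M π (measurableCustomers_stageArrivals M i m (m + 1) (Sum.inr k)) i
    (Sum.inr k) hm.le]
  · apply measure_congr
    filter_upwards [hfin] with ω hω
    apply propext
    refine and_congr_right fun hk => ?_
    exact (inr_mem_eventuallyServed_iff hω hk hm hvisit hbetween).trans (by simp [hE])
  -- Arriving during stage `m` depends on the states at `m` and `m + 1` only, and these involve no
  -- decision at a stage `l > m`.
  · intro l hl ω b
    simp only [Set.mem_ofPred_eq, stageArrivals, inr_mem_arrivals,
      stateAt_setDecision M ω i (Sum.inr k) hl.le, stateAt_setDecision M ω i (Sum.inr k) hl]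
    rfl

lemma tsum_law_stageArrivals_served_exhaustive {i : Fin N} {m : ℕ}
    (hT : ∫⁻ ω, (stateAt M ω m).time ∂(law M π) ≠ ⊤)
    (hfin : ∀ᵐ ω ∂(law M π), ∀ l, (stateAt M ω l).time < ⊤)
    (hm : (stagePeriod m : Period N) = Period.visit i)
    (hE : M.discipline i = Discipline.exhaustive) :
    ∑' k, law M π ({ω | Sum.inr k ∈ stageArrivals M ω i m (m + 1)} ∩
        {ω | Sum.inr k ∈ eventuallyServed M ω i}) =
      ENNReal.ofReal (M.rate i) * ∫⁻ ω, periodLength M ω m ∂(law M π) := by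
  rw [← tsum_law_stageArrivals M π i m hT]
  refine tsum_congr fun k => ?_
  apply measure_congr
  filter_upwards [hfin] with ω hω
  apply propext
  exact ⟨fun h => h.1, fun h => ⟨h, m, (mem_served_iff ..).2 ⟨hm, hω m, Or.inr ⟨hE, h⟩⟩⟩⟩

end Thinning

/-! ### Cyclic bookkeeping: lags, next visits and products of staying probabilities -/

section Cycle

variable {N : ℕ} [NeZero N]

lemma stagePeriod_two_mul (b : ℕ) : (stagePeriod (2 * b) : Period N) = .visit (Fin.ofNat N b) := by
  simp [stagePeriod]

lemma stagePeriod_two_mul_add_one (b : ℕ) :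
    (stagePeriod (2 * b + 1) : Period N) = .switch (Fin.ofNat N b) := by
  have h1 : (2 * b + 1) % 2 = 1 := by lia
  have h2 : (2 * b + 1) / 2 = b := by lia
  simp [stagePeriod, h1, h2]

lemma ofNat_add (a b : ℕ) : Fin.ofNat N (a + b) = Fin.ofNat N a + Fin.ofNat N b := by
  ext; simp [Fin.val_add]

lemma ofNat_mul_add (n : ℕ) (j : Fin N) : Fin.ofNat N (N * n + j) = j := by
  ext; simp [Nat.mod_eq_of_lt j.isLt]

lemma lag_pos (i j : Fin N) : 0 < lag i j := by
  unfold lag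
  split_ifs with h
  · exact Nat.pos_of_neZero N
  · rw [Nat.pos_iff_ne_zero]
    intro h0
    exact h (sub_eq_zero.1 (Fin.ext h0 : i - j = 0)).symm

lemma lag_le (i j : Fin N) : lag i j ≤ N := by
  unfold lag
  split_ifs
  · exact le_rfl
  · exact (i - j).isLt.le

lemma add_lag (i j : Fin N) : j + Fin.ofNat N (lag i j) = i := by
  unfold lag
  split_ifs with h
  · subst h; ext; simp
  · have : Fin.ofNat N ((i - j : Fin N) : ℕ) = i - j := by
      ext; simp
    rw [this, add_sub_cancel]

/-- A number below `N` is determined by its residue. For `j = i` the residue is `0`, which `h0`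
excludes, matching the convention that the lag is then `N`. -/
lemma add_ofNat_ne_of_lt_lag {i j : Fin N} {k : ℕ} (h0 : 0 < k) (hk : k < lag i j) :
    j + Fin.ofNat N k ≠ i := by
  intro h
  have hkN : k < N := hk.trans_le (lag_le i j)
  have h1 : Fin.ofNat N k = i - j := by rw [← h, add_sub_cancel_left]
  have h2 : k = ((i - j : Fin N) : ℕ) := by
    rw [← h1]; simp [Nat.mod_eq_of_lt hkN]
  unfold lag at hk
  split_ifs at hk with hji
  · subst hji; simp at h2; lia
  · lia

/-- The stage of the next visit to queue `i` after queue `j` in cycle `n` has been visited. -/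
def nextVisit (n : ℕ) (i j : Fin N) : ℕ := 2 * (N * n + j + lag i j)

lemma stagePeriod_nextVisit (n : ℕ) (i j : Fin N) :
    (stagePeriod (nextVisit n i j) : Period N) = .visit i := by
  rw [nextVisit, stagePeriod_two_mul, ofNat_add, ofNat_mul_add, add_lag]

lemma stagePeriod_ne_of_lt_nextVisit {n : ℕ} {i j : Fin N} {l : ℕ} (h1 : 2 * (N * n + j) < l)
    (h2 : l < nextVisit n i j) : (stagePeriod l : Period N) ≠ .visit i := by
  rcases Nat.even_or_odd' l with ⟨b, rfl | rfl⟩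
  · rw [stagePeriod_two_mul]
    unfold nextVisit at h2
    obtain ⟨k, rfl⟩ : ∃ k, b = N * n + j + k := ⟨b - (N * n + j), by lia⟩
    rw [ofNat_add, ofNat_mul_add]
    have := add_ofNat_ne_of_lt_lag (i := i) (j := j) (k := k) (by lia) (by lia)
    simpa using this
  · rw [stagePeriod_two_mul_add_one]
    simp

/-- After the switch-over at stage `2 * a + 1` the stages form visit and switch-over pairs, closed
by a lone visit. Reversing the order makes `k` count queues backwards from that visit, as in the
definition of the rates. -/
lemma prod_Ioc_odd_even {α : Type*} [CommMonoid α] (f : ℕ → α) (a : ℕ) {L : ℕ} (hL : 0 < L) :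
    ∏ l ∈ Finset.Ioc (2 * a + 1) (2 * (a + L)), f l =
      f (2 * (a + L)) * ∏ k ∈ Finset.Ico 1 L, (f (2 * (a + L - k)) * f (2 * (a + L - k) + 1)) := by
  have h1 : ∏ l ∈ Finset.Ioc (2 * a + 1) (2 * (a + L)), f l =
      (∏ b ∈ Finset.Ico (a + 1) (a + L), (f (2 * b) * f (2 * b + 1))) * f (2 * (a + L)) := by
    induction L, hL using Nat.le_induction with
    | base =>
      simp only [Finset.Ico_self, Finset.prod_empty, one_mul]
      rw [show 2 * (a + 1) = 2 * a + 1 + 1 by ring, Nat.Ioc_succ_singleton, Finset.prod_singleton]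
    | succ L hL ih =>
      rw [show 2 * (a + (L + 1)) = 2 * (a + L) + 1 + 1 by ring,
        Finset.prod_Ioc_succ_top (by lia), Finset.prod_Ioc_succ_top (by lia), ih,
        show a + (L + 1) = a + L + 1 by ring, Finset.prod_Ico_succ_top (by lia)]
      simp only [mul_assoc]
  rw [h1, mul_comm]
  congr 1
  refine Finset.prod_nbij' (fun b => a + L - b) (fun k => a + L - k) ?_ ?_ ?_ ?_ ?_ <;>
    simp only [Finset.mem_Ico]
  · intro b hb; lia
  · intro k hk; lia
  · intro b hb; lia
  · intro k hk; lia
  · intro b hb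
    rw [show a + L - (a + L - b) = b by lia]

variable (M : Model N)

lemma rate_mul_prod_switch (n : ℕ) (i j : Fin N) :
    M.rate i * ∏ l ∈ Finset.Ioc (stageOf n (Period.switch j)) (nextVisit n i j),
      stayProb M i (stagePeriod l) = rateDuringSwitch M i j := by
  rw [stageOf, nextVisit, prod_Ioc_odd_even _ _ (lag_pos i j), rateDuringSwitch, mul_assoc,
    stagePeriod_two_mul, ofNat_add, ofNat_mul_add, add_lag]
  congr 2
  refine Finset.prod_congr rfl fun k hk => ?_
  rw [Finset.mem_Ico] at hk
  have : Fin.ofNat N (N * n + j + lag i j - k) = i - Fin.ofNat N k := by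
    rw [eq_sub_iff_add_eq, ← ofNat_add, Nat.sub_add_cancel (by lia), ofNat_add, ofNat_mul_add,
      add_lag]
  rw [stagePeriod_two_mul, stagePeriod_two_mul_add_one, this]

/-- Compared with an arrival during the following switch-over, there is one more polling instant to
survive: the start of that switch-over. For `j = i`, with lag `N`, this is the rate during a gated
visit. -/
lemma rate_mul_prod_visit (n : ℕ) (i j : Fin N) :
    M.rate i * ∏ l ∈ Finset.Ioc (stageOf n (Period.visit j)) (nextVisit n i j),
      stayProb M i (stagePeriod l) =
        stayProb M i (Period.switch j) * rateDuringSwitch M i j := by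
  have h := lag_pos i j
  rw [← rate_mul_prod_switch M n i j, mul_left_comm, stageOf, stageOf,
    ← Finset.prod_Ioc_consecutive _ (Nat.le_succ _) (by unfold nextVisit; lia),
    Nat.Ioc_succ_singleton, Finset.prod_singleton, stagePeriod_two_mul_add_one, ofNat_mul_add]

lemma sum_Ico_cycle {α : Type*} [AddCommMonoid α] (f : ℕ → α) (n : ℕ) :
    ∑ m ∈ Finset.Ico (2 * N * n) (2 * N * (n + 1)), f m =
      ∑ j : Fin N, (f (stageOf n (Period.visit j)) + f (stageOf n (Period.switch j))) := by
  have h : ∀ (g : ℕ → α) (K : ℕ), ∑ m ∈ Finset.range (2 * K), g m =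
      ∑ k ∈ Finset.range K, (g (2 * k) + g (2 * k + 1)) := by
    intro g K
    induction K with
    | zero => simp
    | succ K ih =>
      rw [show 2 * (K + 1) = 2 * K + 1 + 1 by ring, Finset.sum_range_succ, Finset.sum_range_succ,
        Finset.sum_range_succ, ih, add_assoc]
  rw [Finset.sum_Ico_eq_sum_range, show 2 * N * (n + 1) - 2 * N * n = 2 * N by
    rw [mul_add, mul_one]; lia, h, Finset.sum_range]
  refine Finset.sum_congr rfl fun j _ => ?_
  simp only [stageOf]
  congr 2 <;> ring

end Cycle

/-! ### Steady-state means -/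

section SteadyState

variable {N : ℕ} [NeZero N] {M : Model N} {π : ProbabilityMeasure (Fin N → ℕ)}

lemma IsSteadyState.lintegral_periodLength (h : IsSteadyState M π) (n : ℕ) {l : ℕ}
    (hl : l < 2 * N) :
    ∫⁻ ω, periodLength M ω (2 * N * n + l) ∂(law M π) = ∫⁻ ω, periodLength M ω l ∂(law M π) := by
  have h1 := ((h n).comp (u := fun r : (Fin N → ℕ∞) × (Fin (2 * N) → ℝ≥0∞) => r.2 ⟨l, hl⟩)
    (by fun_prop)).lintegral_eq
  simpa [Function.comp_def, cycleRecord] using h1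

lemma IsSteadyState.lintegral_periodLength_stageOf (h : IsSteadyState M π) (n : ℕ)
    (P : Period N) :
    ∫⁻ ω, periodLength M ω (stageOf n P) ∂(law M π) = meanPeriod M π P := by
  unfold meanPeriod
  rcases P with j | j
  · have hj := j.isLt
    have h0 : stageOf 0 (Period.visit j) = 2 * (j : ℕ) := by simp [stageOf]
    rw [h0, ← h.lintegral_periodLength n (l := 2 * j) (by lia), stageOf, mul_add, mul_assoc]
  · have hj := j.isLt
    have h0 : stageOf 0 (Period.switch j) = 2 * (j : ℕ) + 1 := by simp [stageOf]
    rw [h0, ← h.lintegral_periodLength n (l := 2 * j + 1) (by lia), stageOf, mul_add, mul_assoc,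
      add_assoc]

lemma meanCycle_eq_sum : meanCycle M π =
    ∑ j, (meanPeriod M π (Period.visit j) + meanPeriod M π (Period.switch j)) := by
  unfold meanCycle cycleLength
  rw [lintegral_finsetSum _ fun m _ => by fun_prop, sum_Ico_cycle]
  rfl

lemma meanPeriod_lt_top (hC : meanCycle M π < ⊤) (P : Period N) : meanPeriod M π P < ⊤ := by
  rw [meanCycle_eq_sum] at hC
  rcases P with j | j
  · exact (ENNReal.add_lt_top.1 (ENNReal.sum_lt_top.1 hC j (Finset.mem_univ j))).1
  · exact (ENNReal.add_lt_top.1 (ENNReal.sum_lt_top.1 hC j (Finset.mem_univ j))).2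

lemma exists_stageOf_eq (m : ℕ) : ∃ (n : ℕ) (P : Period N), stageOf n P = m := by
  have hN : 0 < N := Nat.pos_of_neZero N
  rcases Nat.even_or_odd' m with ⟨b, rfl | rfl⟩
  · exact ⟨b / N, .visit ⟨b % N, Nat.mod_lt _ hN⟩, by simp [stageOf, Nat.div_add_mod]⟩
  · exact ⟨b / N, .switch ⟨b % N, Nat.mod_lt _ hN⟩, by simp [stageOf, Nat.div_add_mod]⟩

/-- A stage time is a finite sum of period lengths, each with a steady-state mean bounded by `E[C]`.
This provides both the cancellation in Wald's identity and almost sure finiteness of all stage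
times. -/
lemma IsSteadyState.lintegral_stateAt_time_ne_top (h : IsSteadyState M π)
    (hC : meanCycle M π < ⊤) (m : ℕ) : ∫⁻ ω, (stateAt M ω m).time ∂(law M π) ≠ ⊤ := by
  simp_rw [stateAt_time_eq_sum]
  rw [lintegral_finsetSum _ fun m _ => by fun_prop]
  refine (ENNReal.sum_lt_top.2 fun l _ => ?_).ne
  obtain ⟨n, P, rfl⟩ := exists_stageOf_eq (N := N) l
  rw [h.lintegral_periodLength_stageOf]
  exact meanPeriod_lt_top hC P

lemma IsSteadyState.ae_stateAt_time_lt_top (h : IsSteadyState M π) (hC : meanCycle M π < ⊤) :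
    ∀ᵐ ω ∂(law M π), ∀ m, (stateAt M ω m).time < ⊤ :=
  ae_all_iff.2 fun m => ae_lt_top (by fun_prop) (h.lintegral_stateAt_time_ne_top hC m)

/-- Tonelli over the arrival index: without initial customers in `A`, its cardinality is a sum of
indicators indexed by `k`. -/
lemma lintegral_encard_of_inl_notMem {A : Scenario N → Set Customer}
    (hA : MeasurableCustomers A) (hinl : ∀ ω k, Sum.inl k ∉ A ω) :
    ∫⁻ ω, ((A ω).encard : ℝ≥0∞) ∂(law M π) = ∑' k, law M π {ω | Sum.inr k ∈ A ω} := by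
  have h : ∀ ω, ((A ω).encard : ℝ≥0∞) =
      ∑' k, {ω | Sum.inr k ∈ A ω}.indicator (1 : Scenario N → ℝ≥0∞) ω := by
    intro ω
    rw [← ENNReal.tsum_set_one, tsum_subtype (A ω) fun _ => (1 : ℝ≥0∞),
      ← (Sum.inr_injective (α := ℕ) (β := ℕ)).tsum_eq]
    · rfl
    · rintro (k | k) hk
      · exact absurd (Set.indicator_of_notMem (hinl ω k) _) hk
      · exact ⟨k, rfl⟩
  simp_rw [h]
  rw [lintegral_tsum fun k => (measurable_one.indicator (hA (Sum.inr k))).aemeasurable]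
  exact tsum_congr fun k => lintegral_indicator_one (hA (Sum.inr k))

lemma IsSteadyState.meanArrivals_eq (h : IsSteadyState M π) (hC : meanCycle M π < ⊤) (n : ℕ)
    (i : Fin N) : meanArrivals M π n i = ENNReal.ofReal (M.rate i) * meanCycle M π := by
  have h1 : meanArrivals M π n i =
      ∑' k, law M π {ω | Sum.inr k ∈ stageArrivals M ω i (2 * N * n) (2 * N * (n + 1))} :=
    lintegral_encard_of_inl_notMem (measurableCustomers_stageArrivals M i _ _)
      fun _ _ => inl_notMem_arrivals
  have h2 := fun k => law_stageArrivals_inter_eq_sum M π i k Set.univ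
    (Nat.mul_le_mul_left (2 * N) n.le_succ)
  simp only [Set.inter_univ, Nat.succ_eq_add_one] at h2
  simp_rw [h1, h2]
  rw [Summable.tsum_finsetSum fun _ _ => ENNReal.summable]
  simp_rw [tsum_law_stageArrivals M π i _ (h.lintegral_stateAt_time_ne_top hC _)]
  rw [← Finset.mul_sum, sum_Ico_cycle, meanCycle_eq_sum]
  simp_rw [h.lintegral_periodLength_stageOf]

lemma rateDuringSwitch_nonneg (M : Model N) (i j : Fin N) : 0 ≤ rateDuringSwitch M i j :=
  mul_nonneg (mul_nonneg (M.rate_pos i).le (stayProb_nonneg M i _))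
    (Finset.prod_nonneg fun _ _ => mul_nonneg (stayProb_nonneg M i _) (stayProb_nonneg M i _))

lemma rateDuringVisit_nonneg (M : Model N) (i j : Fin N) : 0 ≤ rateDuringVisit M i j := by
  unfold rateDuringVisit
  split_ifs
  · exact (M.rate_pos i).le
  · exact mul_nonneg (stayProb_nonneg M i _) (rateDuringSwitch_nonneg M i j)

lemma stagePeriod_stageOf (n : ℕ) (P : Period N) : stagePeriod (stageOf n P) = P := by
  rcases P with j | j
  · rw [stageOf, stagePeriod_two_mul, ofNat_mul_add]
  · rw [stageOf, stagePeriod_two_mul_add_one, ofNat_mul_add]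

lemma IsSteadyState.tsum_served_switch (h : IsSteadyState M π) (hC : meanCycle M π < ⊤) (n : ℕ)
    (i j : Fin N) :
    ∑' k, law M π ({ω | Sum.inr k ∈ stageArrivals M ω i (stageOf n (Period.switch j))
        (stageOf n (Period.switch j) + 1)} ∩ {ω | Sum.inr k ∈ eventuallyServed M ω i}) =
      ENNReal.ofReal (rateDuringSwitch M i j) * meanPeriod M π (Period.switch j) := by
  have hlag := lag_pos i j
  rw [tsum_law_stageArrivals_served M π (h.lintegral_stateAt_time_ne_top hC _)
    (h.ae_stateAt_time_lt_top hC) (by simp [stagePeriod_stageOf])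
    (m' := nextVisit n i j) (by unfold stageOf nextVisit; lia) (stagePeriod_nextVisit n i j)
    (fun l h1 h2 => stagePeriod_ne_of_lt_nextVisit (by unfold stageOf at h1; lia) h2),
    rate_mul_prod_switch, h.lintegral_periodLength_stageOf]

lemma IsSteadyState.tsum_served_visit (h : IsSteadyState M π) (hC : meanCycle M π < ⊤) (n : ℕ)
    (i j : Fin N) :
    ∑' k, law M π ({ω | Sum.inr k ∈ stageArrivals M ω i (stageOf n (Period.visit j))
        (stageOf n (Period.visit j) + 1)} ∩ {ω | Sum.inr k ∈ eventuallyServed M ω i}) =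
      ENNReal.ofReal (rateDuringVisit M i j) * meanPeriod M π (Period.visit j) := by
  have hlag := lag_pos i j
  unfold rateDuringVisit
  split_ifs with hE
  · rw [tsum_law_stageArrivals_served_exhaustive M π (h.lintegral_stateAt_time_ne_top hC _)
      (h.ae_stateAt_time_lt_top hC) (by rw [stagePeriod_stageOf, hE.1]) hE.2,
      h.lintegral_periodLength_stageOf]
  · rw [tsum_law_stageArrivals_served M π (h.lintegral_stateAt_time_ne_top hC _)
      (h.ae_stateAt_time_lt_top hC) (m := stageOf n (Period.visit j))
      (by simpa [stagePeriod_stageOf] using hE) (m' := nextVisit n i j) (by unfold stageOf nextVisit; lia) (stagePeriod_nextVisit n i j)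
      (fun l h1 h2 => stagePeriod_ne_of_lt_nextVisit h1 h2),
      rate_mul_prod_visit, h.lintegral_periodLength_stageOf]

lemma IsSteadyState.meanServed_eq (h : IsSteadyState M π) (hC : meanCycle M π < ⊤) (n : ℕ)
    (i : Fin N) :
    meanServed M π n i =
      ∑ j, (ENNReal.ofReal (rateDuringVisit M i j) * meanPeriod M π (Period.visit j) +
        ENNReal.ofReal (rateDuringSwitch M i j) * meanPeriod M π (Period.switch j)) := by
  have h1 : meanServed M π n i = ∑' k, law M π
      ({ω | Sum.inr k ∈ stageArrivals M ω i (2 * N * n) (2 * N * (n + 1))} ∩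
        {ω | Sum.inr k ∈ eventuallyServed M ω i}) :=
    lintegral_encard_of_inl_notMem
      (A := fun ω => stageArrivals M ω i (2 * N * n) (2 * N * (n + 1)) ∩ eventuallyServed M ω i)
      (fun c => (measurableCustomers_stageArrivals M i _ _ c).inter
        (measurableCustomers_eventuallyServed M i c))
      fun _ _ hk => inl_notMem_arrivals hk.1
  simp_rw [h1, law_stageArrivals_inter_eq_sum M π i _ _
    (Nat.mul_le_mul_left (2 * N) (Nat.le_add_right n 1))]
  rw [Summable.tsum_finsetSum fun _ _ => ENNReal.summable, sum_Ico_cycle]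
  simp_rw [h.tsum_served_switch hC, h.tsum_served_visit hC]

end SteadyState

end Polling

/-! ### The main theorem: from extended to real expectations -/

theorem mainTheorem6 {N : ℕ} [NeZero N] (M : Polling.Model N)
    (π : ProbabilityMeasure (Fin N → ℕ))
    (hsteady : Polling.IsSteadyState M π)
    (hC_pos : 0 < Polling.meanCycle M π) (hC_fin : Polling.meanCycle M π < ⊤) (n : ℕ) :
    (∀ i, 0 < Polling.meanArrivals M π n i ∧ Polling.meanArrivals M π n i < ⊤) ∧
    (∀ i, Polling.servedProbOfType M π n i =
      ∑ j, ((Polling.meanPeriod M π (Polling.Period.visit j)).toReal /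
              (Polling.meanCycle M π).toReal *
              (Polling.rateDuringVisit M i j / M.rate i) +
            (Polling.meanPeriod M π (Polling.Period.switch j)).toReal /
              (Polling.meanCycle M π).toReal *
              (Polling.rateDuringSwitch M i j / M.rate i))) ∧
    Polling.servedProb M π n =
      ∑ i, M.rate i / (∑ j, M.rate j) * Polling.servedProbOfType M π n i := by
  open Polling in
  have hA := hsteady.meanArrivals_eq hC_fin n
  have hA_real : ∀ i, (meanArrivals M π n i).toReal = M.rate i * (meanCycle M π).toReal :=
    fun i => by rw [hA, ENNReal.toReal_mul, ENNReal.toReal_ofReal (M.rate_pos i).le]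
  have hA_bounds : ∀ i, 0 < meanArrivals M π n i ∧ meanArrivals M π n i < ⊤ := fun i => by
    rw [hA]
    exact ⟨ENNReal.mul_pos (ENNReal.ofReal_pos.2 (M.rate_pos i)).ne' hC_pos.ne',
      ENNReal.mul_lt_top ENNReal.ofReal_lt_top hC_fin⟩
  have hterm_ne_top : ∀ i j,
      ENNReal.ofReal (rateDuringVisit M i j) * meanPeriod M π (Period.visit j) ≠ ⊤ ∧
      ENNReal.ofReal (rateDuringSwitch M i j) * meanPeriod M π (Period.switch j) ≠ ⊤ := fun i j =>
    ⟨ENNReal.mul_ne_top ENNReal.ofReal_ne_top (meanPeriod_lt_top hC_fin _).ne,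
      ENNReal.mul_ne_top ENNReal.ofReal_ne_top (meanPeriod_lt_top hC_fin _).ne⟩
  have hS_real : ∀ i, (meanServed M π n i).toReal =
      ∑ j, (rateDuringVisit M i j * (meanPeriod M π (Period.visit j)).toReal +
        rateDuringSwitch M i j * (meanPeriod M π (Period.switch j)).toReal) := fun i => by
    rw [hsteady.meanServed_eq hC_fin, ENNReal.toReal_sum fun j _ =>
      ENNReal.add_ne_top.2 (hterm_ne_top i j)]
    refine Finset.sum_congr rfl fun j _ => ?_
    rw [ENNReal.toReal_add (hterm_ne_top i j).1 (hterm_ne_top i j).2, ENNReal.toReal_mul,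
      ENNReal.toReal_mul, ENNReal.toReal_ofReal (rateDuringVisit_nonneg M i j),
      ENNReal.toReal_ofReal (rateDuringSwitch_nonneg M i j)]
  have hS_ne_top : ∀ i, meanServed M π n i ≠ ⊤ := fun i => by
    rw [hsteady.meanServed_eq hC_fin]
    exact ENNReal.sum_ne_top.2 fun j _ => ENNReal.add_ne_top.2 (hterm_ne_top i j)
  have hC : 0 < (meanCycle M π).toReal := ENNReal.toReal_pos hC_pos.ne' hC_fin.ne
  have hΛ : 0 < ∑ j, M.rate j :=
    Finset.sum_pos (fun j _ => M.rate_pos j) Finset.univ_nonempty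
  refine ⟨hA_bounds, fun i => ?_, ?_⟩
  · rw [servedProbOfType, ENNReal.toReal_div, hS_real, hA_real, Finset.sum_div]
    refine Finset.sum_congr rfl fun j _ => ?_
    have := M.rate_pos i
    field_simp
  -- The expected numbers of arrivals are `λ_i E[C]`, so `E[C]` cancels from the weights and leaves
  -- `λ_i / Λ`.
  · rw [servedProb, ENNReal.toReal_div, ENNReal.toReal_sum fun i _ => hS_ne_top i,
      ENNReal.toReal_sum fun i _ => (hA_bounds i).2.ne]
    simp_rw [hA_real]
    rw [← Finset.sum_mul, Finset.sum_div]
    refine Finset.sum_congr rfl fun i _ => ?_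
    rw [servedProbOfType, ENNReal.toReal_div, hA_real]
    have := M.rate_pos i
    field_simp
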